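/- Identify $S^3$ with $\mathrm{SU}(2)$, with its invariant measure, and let $\mathfrak h = L^2(S^3)\otimes\mathbb C^2$, the Hilbert space of square-integrable functions $\psi\colon S^3\to\mathbb C^2$ (bound states of the hydrogen atom with spin). Let $\mathrm{SU}(2)\times\mathrm{SU}(2)$ act on $\mathfrak h$ by the unitary representation $$(\rho(g_1,g_2)\psi)(g) = g_2\,\psi(g_1^{-1} g g_2).$$ Let $\sigma_1,\sigma_2,\sigma_3$ be the Pauli matrices, let $B_j$ be the self-adjoint generator of right translations, $(e^{itB_j}\psi)(g)=\psi(g\,e^{it\sigma_j/2})$, let $S_j = 1\otimes\frac12\sigma_j$, and let $$D = 4\sum_{j=1}^3 B_jS_j + \tfrac32$$ be the Dirac operator of the unit sphere $S^3$, a self-adjoint operator on $\mathfrak h$ whose domain is the common domain of the $B_j$. The space $\mathfrak h$ is the orthogonal direct sum of the closed span of the eigenvectors of $D$ with positive eigenvalue and the closed span of those with negative eigenvalue; let $p_+$ and $p_-$ be the projections onto these two subspaces, so that $S = D/|D| = p_+-p_-$. Let $\mathcal H$ be $\mathfrak h$ with the same norm but with the complex structure $j = iS$ in place of $i$ (the Hilbert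 space of the left-handed Weyl equation on the Einstein universe $\mathbb R\times S^3$), and let $I\colon\mathfrak h\to\mathcal H$ be the identity map. The operators $\rho(g_1,g_2)$ and $D$ are also complex-linear on $\mathcal H$; on $\mathcal H$ they define a unitary representation $\rho_{\mathcal H}$ and a self-adjoint operator, again written $D$. Let $$(C\psi)(g) = \epsilon\,\overline{\psi(g)},\qquad \epsilon=\begin{pmatrix}0&1\\-1&0\end{pmatrix},\qquad F = I(p_+ + C p_-)\colon \mathfrak h\to\mathcal H .$$ The map $F$ is unitary. For a complex Hilbert space $\mathfrak k$, let $\Lambda(\mathfrak k)$ be the fermionic Fock space, i.e. the Hilbert space completion of the exterior algebra of $\mathfrak k$ with the inner product for which different degrees are orthogonal and $\langle u_1\wedge\dots\wedge u_n, v_1\wedge\dots\wedge v_n\rangle=\det(\langle u_i,v_j\rangle)$. For a unitary map $U\colon\mathfrak k\to\mathfrak k'$ let $\Lambda(U)\colon\Lambda(\mathfrak k)\to\Lambda(\mathfrak k')$ be the unitary map with $\Lambda(U)(\psi_1\wedge\dots\wedge\psi_n)=U\psi_1\wedge\dots\wedge U\psi_n$; for a self-adjoint operator $A$ on $\mathfrak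 k$ let $d\Lambda(A)$ be the self-adjoint generator of the one-parameter unitary group $t\mapsto\Lambda(e^{itA})$ on $\Lambda(\mathfrak k)$. **Theorem.** The unitary map $\Lambda(F)\colon\Lambda(\mathfrak h)\to\Lambda(\mathcal H)$ is a unitary equivalence between the strongly continuous unitary representations $\Lambda(\rho)$ and $\Lambda(\rho_{\mathcal H})$ of $\mathrm{SU}(2)\times\mathrm{SU}(2)$: $$\Lambda(F)\,\Lambda(\rho(g_1,g_2)) = \Lambda(\rho_{\mathcal H}(g_1,g_2))\,\Lambda(F)\qquad\text{for all }(g_1,g_2)\in \mathrm{SU}(2)\times\mathrm{SU}(2).$$ Moreover $\Lambda(F)$ maps the domain of $d\Lambda(D)$ on $\Lambda(\mathfrak h)$ onto the domain of $d\Lambda(D)$ on $\Lambda(\mathcal H)$, and $\Lambda(F)\,d\Lambda(D) = d\Lambda(D)\,\Lambda(F)$ on the domain of $d\Lambda(D)$. -/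

import Mathlib

open MeasureTheory
open scoped InnerProductSpace ENNReal Matrix

namespace KeplerFock

noncomputable section

section FockSpace

variable {E : Type*} [NormedAddCommGroup E] [InnerProductSpace ℂ E]
variable {E' : Type*} [NormedAddCommGroup E'] [InnerProductSpace ℂ E']
variable {E'' : Type*} [NormedAddCommGroup E''] [InnerProductSpace ℂ E'']

/-- For fixed `u₁, …, uₙ`, the alternating map `(v₁, …, vₙ) ↦ det ⟪uᵢ, vⱼ⟫`. -/
def gramForm (n : ℕ) (u : Fin n → E) : E [⋀^Fin n]→ₗ[ℂ] ℂ :=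
  (Matrix.detRowAlternating (n := Fin n) (R := ℂ)).compLinearMap
    (LinearMap.pi fun i => (innerₛₗ ℂ (u i) : E →ₗ[ℂ] ℂ))

theorem gramForm_apply (n : ℕ) (u v : Fin n → E) :
    gramForm n u v = Matrix.det (Matrix.of fun i j => ⟪u j, v i⟫_ℂ) := rfl

/-- The linear functional `⟪u₁ ∧ ⋯ ∧ uₙ, ·⟫` on the exterior algebra: it is the Gram determinant on
wedge products of `n` vectors and vanishes on the other degrees. -/
def wedgeFunctional (n : ℕ) (u : Fin n → E) : ExteriorAlgebra ℂ E →ₗ[ℂ] ℂ :=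
  ExteriorAlgebra.liftAlternating (Pi.single n (gramForm n u))

theorem wedgeFunctional_wedge (n m : ℕ) (u : Fin n → E) (v : Fin m → E) :
    wedgeFunctional n u (ExteriorAlgebra.ιMulti ℂ m v) =
      (Pi.single n (gramForm n u) : (i : ℕ) → E [⋀^Fin i]→ₗ[ℂ] ℂ) m v := by
  rw [wedgeFunctional, ExteriorAlgebra.liftAlternating_apply_ιMulti]

/-- Pointwise complex conjugation, from linear to conjugate-linear functionals. -/
def starFunctional : (ExteriorAlgebra ℂ E →ₗ[ℂ] ℂ) →ₗ⋆[ℂ] (ExteriorAlgebra ℂ E →ₗ⋆[ℂ] ℂ) where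
  toFun f :=
    { toFun := fun x => starRingEnd ℂ (f x)
      map_add' := by simp
      map_smul' := by simp }
  map_add' f g := by ext; simp
  map_smul' c f := by ext; simp

theorem gramForm_update_add (n : ℕ) [inst : DecidableEq (Fin n)] (u : Fin n → E) (i : Fin n) (x y : E) :
    gramForm n (Function.update u i (x + y)) =
      gramForm n (Function.update u i x) + gramForm n (Function.update u i y) := by
  obtain rfl : inst = instDecidableEqFin n := Subsingleton.elim _ _
  ext v
  have key : ∀ z, (Matrix.of fun k j => ⟪Function.update u i z j, v k⟫_ℂ) =
      Matrix.updateCol (Matrix.of fun k j => ⟪u j, v k⟫_ℂ) i (fun k => ⟪z, v k⟫_ℂ) := by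
    intro z
    ext k j
    by_cases h : j = i
    · subst h; simp
    · simp [h]
  rw [AlternatingMap.add_apply]
  simp only [gramForm_apply, key, inner_add_left]
  exact Matrix.det_updateCol_add (R := ℂ) (Matrix.of fun k j => ⟪u j, v k⟫_ℂ) i
    (fun k => ⟪x, v k⟫_ℂ) (fun k => ⟪y, v k⟫_ℂ)

theorem gramForm_update_smul (n : ℕ) [inst : DecidableEq (Fin n)] (u : Fin n → E) (i : Fin n) (c : ℂ) (x : E) :
    gramForm n (Function.update u i (c • x)) =
      starRingEnd ℂ c • gramForm n (Function.update u i x) := by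
  obtain rfl : inst = instDecidableEqFin n := Subsingleton.elim _ _
  ext v
  have key : ∀ z, (Matrix.of fun k j => ⟪Function.update u i z j, v k⟫_ℂ) =
      Matrix.updateCol (Matrix.of fun k j => ⟪u j, v k⟫_ℂ) i (fun k => ⟪z, v k⟫_ℂ) := by
    intro z
    ext k j
    by_cases h : j = i
    · subst h; simp
    · simp [h]
  rw [AlternatingMap.smul_apply]
  simp only [gramForm_apply, key, inner_smul_left]
  exact Matrix.det_updateCol_smul (R := ℂ) (Matrix.of fun k j => ⟪u j, v k⟫_ℂ) i
    (starRingEnd ℂ c) (fun k => ⟪x, v k⟫_ℂ)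

theorem gramForm_eq_zero (n : ℕ) (u : Fin n → E) (i j : Fin n) (h : u i = u j) (hij : i ≠ j) :
    gramForm n u = 0 := by
  ext v
  rw [gramForm_apply]
  exact Matrix.det_zero_of_column_eq hij (fun k => by simp [h])

theorem wedgeFunctional_eq (n : ℕ) (u : Fin n → E) :
    wedgeFunctional n u =
      (ExteriorAlgebra.liftAlternating ∘ₗ LinearMap.single ℂ
        (fun i : ℕ => E [⋀^Fin i]→ₗ[ℂ] ℂ) n) (gramForm n u) := rfl

/-- The functional `x ↦ ⟪x, u₁ ∧ ⋯ ∧ uₙ⟫`, as an alternating function of `u₁, …, uₙ`. -/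
def wedgeAlternating (n : ℕ) : E [⋀^Fin n]→ₗ[ℂ] (ExteriorAlgebra ℂ E →ₗ⋆[ℂ] ℂ) where
  toFun u := starFunctional (wedgeFunctional n u)
  map_update_add' u i x y := by
    simp only [wedgeFunctional_eq, gramForm_update_add, map_add]
  map_update_smul' u i c x := by
    simp only [wedgeFunctional_eq, gramForm_update_smul, map_smul, map_smulₛₗ, Complex.conj_conj]
  map_eq_zero_of_eq' u i j h hij := by
    simp only [wedgeFunctional_eq, gramForm_eq_zero n u i j h hij, map_zero]

/-- The sesquilinear form of the exterior algebra: `fockForm y x = ⟪x, y⟫`. -/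
def fockForm : ExteriorAlgebra ℂ E →ₗ[ℂ] (ExteriorAlgebra ℂ E →ₗ⋆[ℂ] ℂ) :=
  ExteriorAlgebra.liftAlternating fun n => wedgeAlternating n

theorem fockForm_wedge_self (n : ℕ) (u v : Fin n → E) :
    fockForm (ExteriorAlgebra.ιMulti ℂ n v) (ExteriorAlgebra.ιMulti ℂ n u) =
      Matrix.det (Matrix.of fun i j => ⟪u i, v j⟫_ℂ) := by
  rw [fockForm, ExteriorAlgebra.liftAlternating_apply_ιMulti]
  change starRingEnd ℂ (wedgeFunctional n v _) = _
  rw [wedgeFunctional_wedge, Pi.single_eq_same, gramForm_apply, RingHom.map_det]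
  congr 1
  ext i j
  simp

theorem fockForm_wedge_ne (n m : ℕ) (h : m ≠ n) (u : Fin m → E) (v : Fin n → E) :
    fockForm (ExteriorAlgebra.ιMulti ℂ n v) (ExteriorAlgebra.ιMulti ℂ m u) = 0 := by
  rw [fockForm, ExteriorAlgebra.liftAlternating_apply_ιMulti]
  change starRingEnd ℂ (wedgeFunctional n v _) = _
  rw [wedgeFunctional_wedge, Pi.single_eq_of_ne h, AlternatingMap.zero_apply, map_zero]

theorem wedge_induction {C : ExteriorAlgebra ℂ E → Prop} (h0 : C 0)
    (hadd : ∀ x y, C x → C y → C (x + y)) (hsmul : ∀ (c : ℂ) x, C x → C (c • x))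
    (hw : ∀ n (u : Fin n → E), C (ExteriorAlgebra.ιMulti ℂ n u)) (x) : C x := by
  have hx : x ∈ Submodule.span ℂ
      (Set.range fun x : Σ n, (Fin n → E) => ExteriorAlgebra.ιMulti ℂ x.1 x.2) := by
    rw [ExteriorAlgebra.ιMulti_span]; trivial
  induction hx using Submodule.span_induction with
  | mem x h => obtain ⟨⟨n, u⟩, rfl⟩ := h; exact hw n u
  | zero => exact h0
  | add x y _ _ hx hy => exact hadd x y hx hy
  | smul c x _ hx => exact hsmul c x hx

theorem fockForm_map (f : E →ₗᵢ[ℂ] E') (x y : ExteriorAlgebra ℂ E) :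
    fockForm (ExteriorAlgebra.map f.toLinearMap x) (ExteriorAlgebra.map f.toLinearMap y) =
      fockForm x y := by
  induction x using wedge_induction with
  | h0 => simp
  | hadd a b ha hb => simp [ha, hb]
  | hsmul c a ha => simp [ha]
  | hw n v =>
    induction y using wedge_induction with
    | h0 => simp
    | hadd a b ha hb => rw [map_add, map_add, map_add, ha, hb]
    | hsmul c a ha => rw [map_smul, map_smulₛₗ, map_smulₛₗ, ha]
    | hw m u =>
      rw [ExteriorAlgebra.map_apply_ιMulti, ExteriorAlgebra.map_apply_ιMulti]
      by_cases h : m = n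
      · subst h
        simp [fockForm_wedge_self]
      · rw [fockForm_wedge_ne _ _ h, fockForm_wedge_ne _ _ h]

theorem fockForm_conj (x y : ExteriorAlgebra ℂ E) :
    starRingEnd ℂ (fockForm x y) = fockForm y x := by
  induction x using wedge_induction with
  | h0 => simp
  | hadd a b ha hb => simp [ha, hb]
  | hsmul c a ha => simp [ha]
  | hw n v =>
    induction y using wedge_induction with
    | h0 => simp
    | hadd a b ha hb => simp [ha, hb]
    | hsmul c a ha => simp [ha]
    | hw m u =>
      by_cases h : m = n
      · subst h
        rw [fockForm_wedge_self, fockForm_wedge_self, RingHom.map_det, ← Matrix.det_transpose]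
        congr 1
        ext i j
        simp
      · rw [fockForm_wedge_ne _ _ h, fockForm_wedge_ne _ _ (Ne.symm h), map_zero]

theorem exists_finiteDimensional (x : ExteriorAlgebra ℂ E) :
    ∃ (V : Submodule ℂ E) (_ : FiniteDimensional ℂ V) (y : ExteriorAlgebra ℂ V),
      ExteriorAlgebra.map V.subtype y = x := by
  have mono : ∀ (V W : Submodule ℂ E) (hVW : V ≤ W) (y : ExteriorAlgebra ℂ V),
      ExteriorAlgebra.map W.subtype (ExteriorAlgebra.map (Submodule.inclusion hVW) y) =
        ExteriorAlgebra.map V.subtype y := by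
    intro V W hVW y
    rw [← AlgHom.comp_apply, ExteriorAlgebra.map_comp_map]
    rfl
  induction x using wedge_induction with
  | h0 => exact ⟨⊥, inferInstance, 0, by simp⟩
  | hadd a b ha hb =>
    obtain ⟨V, hV, y, rfl⟩ := ha
    obtain ⟨W, hW, z, rfl⟩ := hb
    exact ⟨V ⊔ W, inferInstance, ExteriorAlgebra.map (Submodule.inclusion le_sup_left) y +
      ExteriorAlgebra.map (Submodule.inclusion le_sup_right) z, by rw [map_add, mono, mono]⟩
  | hsmul c a ha =>
    obtain ⟨V, hV, y, rfl⟩ := ha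
    exact ⟨V, hV, c • y, by simp⟩
  | hw n u =>
    refine ⟨Submodule.span ℂ (Set.range u), FiniteDimensional.span_of_finite ℂ (Set.finite_range u),
      ExteriorAlgebra.ιMulti ℂ n fun i => ⟨u i, Submodule.subset_span ⟨i, rfl⟩⟩, ?_⟩
    rw [ExteriorAlgebra.map_apply_ιMulti]
    rfl

/-- Ordered wedge products of an orthonormal basis are orthonormal. -/
theorem fockForm_basis {d : ℕ} (b : OrthonormalBasis (Fin d) ℂ E) (s t : Finset (Fin d)) :
    fockForm (b.toBasis.ExteriorAlgebra t) (b.toBasis.ExteriorAlgebra s) =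
      if s = t then 1 else 0 := by
  have hb : ∀ i j, ⟪b i, b j⟫_ℂ = if i = j then 1 else 0 := orthonormal_iff_ite.mp b.orthonormal
  by_cases hc : s.card = t.card
  · rw [ExteriorAlgebra.basis_apply_ofCard b.toBasis hc,
      ExteriorAlgebra.basis_apply_ofCard b.toBasis rfl, ExteriorAlgebra.ιMulti_family,
      ExteriorAlgebra.ιMulti_family, fockForm_wedge_self]
    split_ifs with hst
    · subst hst
      rw [← Matrix.det_one (n := Fin s.card) (R := ℂ)]
      congr 1
      ext i j
      simp [hb, Matrix.one_apply]
    · obtain ⟨k, hks, hkt⟩ : ∃ k ∈ s, k ∉ t := by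
        by_contra! hsub
        exact hst (Finset.eq_of_subset_of_card_le hsub hc.ge)
      obtain ⟨i, hi⟩ := (Set.powersetCard.mem_range_ofFinEmbEquiv_symm_iff_mem
        (Set.powersetCard.ofCard hc) k).mpr hks
      refine Matrix.det_eq_zero_of_row_eq_zero i fun j => ?_
      have hj := (Set.powersetCard.mem_range_ofFinEmbEquiv_symm_iff_mem
        (Set.powersetCard.ofCard (rfl : t.card = t.card)) _).mp ⟨j, rfl⟩
      simp only [Function.comp_apply, OrthonormalBasis.coe_toBasis, Matrix.of_apply, hb, hi]
      rw [if_neg]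
      rintro rfl
      exact hkt hj
  · rw [ExteriorAlgebra.basis_apply_ofCard b.toBasis (rfl : s.card = s.card),
      ExteriorAlgebra.basis_apply_ofCard b.toBasis (rfl : t.card = t.card),
      ExteriorAlgebra.ιMulti_family, ExteriorAlgebra.ιMulti_family, fockForm_wedge_ne _ _ hc,
      if_neg]
    rintro rfl
    exact hc rfl

theorem fockForm_self (x : ExteriorAlgebra ℂ E) :
    0 ≤ (fockForm x x).re ∧ (fockForm x x = 0 → x = 0) := by
  obtain ⟨V, hV, y, rfl⟩ := exists_finiteDimensional x
  have h1 := fockForm_map V.subtypeₗᵢ y y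
  change fockForm (ExteriorAlgebra.map V.subtype y) (ExteriorAlgebra.map V.subtype y) = _ at h1
  rw [h1]
  let b := stdOrthonormalBasis ℂ V
  let B := b.toBasis.ExteriorAlgebra
  have h2 : fockForm y y = ((∑ s, ‖B.repr y s‖ ^ 2 : ℝ) : ℂ) := by
    conv_lhs => rw [← B.sum_repr y]
    simp only [map_sum, LinearMap.sum_apply, map_smul, LinearMap.smul_apply, map_smulₛₗ, B,
      fockForm_basis]
    simp [Complex.conj_mul']
  rw [h2]
  refine ⟨by rw [Complex.ofReal_re]; positivity, fun h => ?_⟩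
  rw [Complex.ofReal_eq_zero, Finset.sum_eq_zero_iff_of_nonneg (fun _ _ => by positivity)] at h
  have : y = 0 := by
    rw [← B.sum_repr y]
    refine Finset.sum_eq_zero fun s hs => ?_
    have := h s hs
    simp only [ne_eq, OfNat.ofNat_ne_zero, not_false_eq_true, pow_eq_zero_iff, norm_eq_zero] at this
    rw [this, zero_smul]
  rw [this, map_zero]

/-- The inner product on the exterior algebra for which the different degrees are orthogonal and
`⟪u₁ ∧ ⋯ ∧ uₙ, v₁ ∧ ⋯ ∧ vₙ⟫ = det ⟪uᵢ, vⱼ⟫`; equivalently, the ordered wedge products of the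
members of an orthonormal basis are orthonormal. -/
@[reducible] def fockCore (E : Type*) [NormedAddCommGroup E] [InnerProductSpace ℂ E] :
    InnerProductSpace.Core ℂ (ExteriorAlgebra ℂ E) where
  inner x y := fockForm y x
  conj_inner_symm x y := fockForm_conj x y
  re_inner_nonneg x := (fockForm_self x).1
  add_left x y z := by simp
  smul_left x y c := by simp
  definite x h := (fockForm_self x).2 h

instance : NormedAddCommGroup (ExteriorAlgebra ℂ E) :=
  (fockCore E).toNormedAddCommGroup

instance : InnerProductSpace ℂ (ExteriorAlgebra ℂ E) :=
  InnerProductSpace.ofCore (fockCore E).toCore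

theorem inner_wedge (n : ℕ) (u v : Fin n → E) :
    ⟪ExteriorAlgebra.ιMulti ℂ n u, ExteriorAlgebra.ιMulti ℂ n v⟫_ℂ =
      Matrix.det (Matrix.of fun i j => ⟪u i, v j⟫_ℂ) :=
  fockForm_wedge_self n u v

theorem inner_wedge_of_ne (n m : ℕ) (h : m ≠ n) (u : Fin m → E) (v : Fin n → E) :
    ⟪ExteriorAlgebra.ιMulti ℂ m u, ExteriorAlgebra.ιMulti ℂ n v⟫_ℂ = 0 :=
  fockForm_wedge_ne n m h u v

/-- The fermionic Fock space: the Hilbert space completion of the exterior algebra. -/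
abbrev Fock (E : Type*) [NormedAddCommGroup E] [InnerProductSpace ℂ E] : Type _ :=
  UniformSpace.Completion (ExteriorAlgebra ℂ E)

/-- The isometry `ψ₁ ∧ ⋯ ∧ ψₙ ↦ U ψ₁ ∧ ⋯ ∧ U ψₙ` of exterior algebras induced by a unitary `U`. -/
def wedgeMap (U : E ≃ₗᵢ[ℂ] E') : ExteriorAlgebra ℂ E →ₗᵢ[ℂ] ExteriorAlgebra ℂ E' where
  toLinearMap := (ExteriorAlgebra.map U.toLinearEquiv.toLinearMap).toLinearMap
  norm_map' x := by
    have h := fockForm_map U.toLinearIsometry x x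
    rw [@norm_eq_sqrt_re_inner ℂ, @norm_eq_sqrt_re_inner ℂ]
    exact congrArg (fun z : ℂ => Real.sqrt z.re) h

theorem wedgeMap_wedge (U : E ≃ₗᵢ[ℂ] E') (n : ℕ) (u : Fin n → E) :
    wedgeMap U (ExteriorAlgebra.ιMulti ℂ n u) = ExteriorAlgebra.ιMulti ℂ n (U ∘ u) :=
  ExteriorAlgebra.map_apply_ιMulti _ _

theorem wedgeMap_refl (x : ExteriorAlgebra ℂ E) : wedgeMap (LinearIsometryEquiv.refl ℂ E) x = x :=
  DFunLike.congr_fun (ExteriorAlgebra.map_id (R := ℂ) (M := E)) x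

theorem wedgeMap_trans (U : E ≃ₗᵢ[ℂ] E') (V : E' ≃ₗᵢ[ℂ] E'') (x : ExteriorAlgebra ℂ E) :
    wedgeMap (U.trans V) x = wedgeMap V (wedgeMap U x) :=
  (DFunLike.congr_fun (ExteriorAlgebra.map_comp_map U.toLinearEquiv.toLinearMap
    V.toLinearEquiv.toLinearMap) x).symm

/-- The continuous extension of `wedgeMap U` to the Fock spaces. -/
def fockHom (U : E ≃ₗᵢ[ℂ] E') : Fock E →L[ℂ] Fock E' :=
  (wedgeMap U).toContinuousLinearMap.completion

theorem fockHom_coe (U : E ≃ₗᵢ[ℂ] E') (x : ExteriorAlgebra ℂ E) :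
    fockHom U (x : Fock E) = (wedgeMap U x : Fock E') :=
  ContinuousLinearMap.completion_apply_coe _ _

theorem fockHom_refl (x : Fock E) : fockHom (LinearIsometryEquiv.refl ℂ E) x = x := by
  induction x using UniformSpace.Completion.induction_on with
  | hp => exact isClosed_eq (fockHom _).continuous continuous_id
  | ih x => rw [fockHom_coe, wedgeMap_refl]

theorem fockHom_trans (U : E ≃ₗᵢ[ℂ] E') (V : E' ≃ₗᵢ[ℂ] E'') (x : Fock E) :
    fockHom (U.trans V) x = fockHom V (fockHom U x) := by
  induction x using UniformSpace.Completion.induction_on with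
  | hp => exact isClosed_eq (fockHom _).continuous ((fockHom _).continuous.comp (fockHom _).continuous)
  | ih x => rw [fockHom_coe, fockHom_coe, fockHom_coe, wedgeMap_trans]

/-- The unitary operator `Λ(U)` between fermionic Fock spaces induced by a unitary operator `U`. -/
def fockMap (U : E ≃ₗᵢ[ℂ] E') : Fock E ≃ₗᵢ[ℂ] Fock E' where
  toFun := fockHom U
  map_add' := map_add _
  map_smul' := map_smul _
  invFun := fockHom U.symm
  left_inv x := by rw [← fockHom_trans, U.self_trans_symm, fockHom_refl]
  right_inv x := by rw [← fockHom_trans, U.symm_trans_self, fockHom_refl]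
  norm_map' x := by
    change ‖fockHom U x‖ = ‖x‖
    induction x using UniformSpace.Completion.induction_on with
    | hp => exact isClosed_eq (fockHom _).continuous.norm continuous_norm
    | ih x =>
      rw [fockHom_coe, UniformSpace.Completion.norm_coe, UniformSpace.Completion.norm_coe,
        LinearIsometry.norm_map]

theorem fockMap_wedge (U : E ≃ₗᵢ[ℂ] E') (n : ℕ) (u : Fin n → E) :
    fockMap U (ExteriorAlgebra.ιMulti ℂ n u : ExteriorAlgebra ℂ E) =
      (ExteriorAlgebra.ιMulti ℂ n (U ∘ u) : ExteriorAlgebra ℂ E') := by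
  rw [← wedgeMap_wedge]
  exact fockHom_coe U _

/-- The representation `Λ(R)` on the Fock space induced by a unitary representation `R`. -/
def fockRep {G : Type*} [Group G] (R : G →* (E ≃ₗᵢ[ℂ] E)) : G →* (Fock E ≃ₗᵢ[ℂ] Fock E) where
  toFun g := fockMap (R g)
  map_one' := by
    rw [map_one]
    exact LinearIsometryEquiv.ext fockHom_refl
  map_mul' g h := by
    rw [map_mul]
    exact LinearIsometryEquiv.ext (fockHom_trans (R h) (R g))

end FockSpace

section Operators

variable {E : Type*} [NormedAddCommGroup E] [InnerProductSpace ℂ E]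

/-- The operator `A = -i d/dt U(t)` at `t = 0`, defined on all vectors at which this derivative exists in
norm. For a strongly continuous one-parameter unitary group it is the self-adjoint generator of
Stone's theorem. -/
def stoneGenerator (U : ℝ → (E ≃ₗᵢ[ℂ] E)) : E →ₗ.[ℂ] E where
  domain :=
    { carrier := {ψ | DifferentiableAt ℝ (fun t => U t ψ) 0}
      add_mem' := fun {x y} hx hy => by
        simp only [Set.mem_ofPred_eq, map_add] at hx hy ⊢
        exact hx.add hy
      zero_mem' := by simp
      smul_mem' := fun c x hx => by
        simp only [Set.mem_ofPred_eq, map_smul] at hx ⊢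
        exact hx.const_smul c }
  toFun :=
    { toFun := fun ψ => -Complex.I • deriv (fun t => U t (ψ : E)) 0
      map_add' := fun x y => by
        have h : deriv (fun t => U t ((x : E) + y)) 0 =
            deriv (fun t => U t (x : E)) 0 + deriv (fun t => U t (y : E)) 0 := by
          simp only [map_add]
          exact deriv_fun_add x.2 y.2
        simp only [Submodule.coe_add, h, smul_add]
      map_smul' := fun c x => by
        have h : deriv (fun t => U t (c • (x : E))) 0 = c • deriv (fun t => U t (x : E)) 0 := by
          simp only [map_smul]
          exact deriv_fun_const_smul c x.2
        simp only [Submodule.coe_smul, h, RingHom.id_apply]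
        rw [smul_comm] }

/-- `U(t) = exp(i t A)`: `U` is a strongly continuous one-parameter unitary group with generator `A`
(equality of unbounded operators, including their domains). -/
structure IsUnitaryGroupOf (A : E →ₗ.[ℂ] E) (U : ℝ → (E ≃ₗᵢ[ℂ] E)) : Prop where
  zero : U 0 = 1
  add : ∀ s t, U (s + t) = U s * U t
  continuous : ∀ ψ, Continuous fun t => U t ψ
  generator : stoneGenerator U = A

/-- The one-parameter unitary group `t ↦ exp(i t A)`, unique by Stone's theorem
(an arbitrary value if there is none). -/
def unitaryGroup (A : E →ₗ.[ℂ] E) : ℝ → (E ≃ₗᵢ[ℂ] E) :=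
  Classical.epsilon (IsUnitaryGroupOf A)

/-- The closed linear span of the eigenvectors of `A` with an eigenvalue in `s`. -/
def eigenSpan (A : E →ₗ.[ℂ] E) (s : Set ℝ) : Submodule ℂ E :=
  (Submodule.span ℂ
    {ψ : E | ∃ l ∈ s, ∃ h : ψ ∈ A.domain, A ⟨ψ, h⟩ = (l : ℂ) • ψ}).topologicalClosure

instance [CompleteSpace E] (A : E →ₗ.[ℂ] E) (s : Set ℝ) : CompleteSpace (eigenSpan A s) :=
  (Submodule.isClosed_topologicalClosure _).completeSpace_coe

/-- The second quantization `dΛ(A)`: the generator of the unitary group `t ↦ Λ(exp(i t A))` on the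
fermionic Fock space. -/
def dFock (A : E →ₗ.[ℂ] E) : Fock E →ₗ.[ℂ] Fock E :=
  stoneGenerator fun t => fockMap (unitaryGroup A t)

/-- The operator `4 ∑ⱼ Sⱼ Bⱼ + 3/2` on the common domain of the operators `Bⱼ`. -/
def diracOf (B : Fin 3 → (E →ₗ.[ℂ] E)) (S : Fin 3 → (E →L[ℂ] E)) : E →ₗ.[ℂ] E where
  domain := ⨅ j, (B j).domain
  toFun :=
    { toFun := fun ψ =>
        (4 : ℂ) • (∑ j, S j (B j ⟨ψ, (Submodule.mem_iInf _).mp ψ.2 j⟩)) + (3 / 2 : ℂ) • (ψ : E)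
      map_add' := fun x y => by
        have h : ∀ j, B j ⟨((x + y : _) : E), (Submodule.mem_iInf _).mp (x + y).2 j⟩ =
            B j ⟨x, (Submodule.mem_iInf _).mp x.2 j⟩ + B j ⟨y, (Submodule.mem_iInf _).mp y.2 j⟩ :=
          fun j => (B j).toFun.map_add ⟨x, (Submodule.mem_iInf _).mp x.2 j⟩
            ⟨y, (Submodule.mem_iInf _).mp y.2 j⟩
        simp only [h, map_add, Finset.sum_add_distrib]
        simp only [Submodule.coe_add, smul_add]
        abel
      map_smul' := fun c x => by
        have h : ∀ j, B j ⟨((c • x : _) : E), (Submodule.mem_iInf _).mp (c • x).2 j⟩ =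
            c • B j ⟨x, (Submodule.mem_iInf _).mp x.2 j⟩ :=
          fun j => (B j).toFun.map_smul c ⟨x, (Submodule.mem_iInf _).mp x.2 j⟩
        simp only [h, map_smul, ← Finset.smul_sum]
        simp only [Submodule.coe_smul, RingHom.id_apply]
        module }

end Operators

section Twist
variable {E : Type*} [NormedAddCommGroup E] [InnerProductSpace ℂ E]
variable (K : Submodule ℂ E) [K.HasOrthogonalProjection]

/-- The operator that is `-1` on `K` and `+1` on the orthogonal complement of `K`. -/
def signOp : E →L[ℂ] E := ContinuousLinearMap.id ℂ E - (2 : ℂ) • K.starProjection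

theorem signOp_apply (ψ : E) : signOp K ψ = ψ - (2 : ℂ) • K.starProjection ψ := rfl

theorem signOp_signOp (ψ : E) : signOp K (signOp K ψ) = ψ := by
  have h : K.starProjection (K.starProjection ψ) = K.starProjection ψ :=
    Submodule.starProjection_eq_self_iff.mpr (Submodule.starProjection_apply_mem K ψ)
  simp only [signOp_apply, map_sub, map_smul, h]
  module

theorem inner_signOp (u v : E) : ⟪signOp K u, v⟫_ℂ = ⟪u, signOp K v⟫_ℂ := by
  simp only [signOp_apply, inner_sub_left, inner_sub_right, inner_smul_left, inner_smul_right,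
    Submodule.inner_starProjection_left_eq_right, map_ofNat]

/-- The complex structure `j = i S`, with `S = signOp K`. -/
def newI (ψ : E) : E := Complex.I • signOp K ψ

theorem newI_add (u v : E) : newI K (u + v) = newI K u + newI K v := by
  simp [newI]

theorem newI_smul (c : ℂ) (u : E) : newI K (c • u) = c • newI K u := by
  rw [newI, newI, map_smul, smul_comm]

theorem newI_newI (u : E) : newI K (newI K u) = -u := by
  rw [newI, newI, map_smul, signOp_signOp, smul_smul, Complex.I_mul_I, neg_one_smul]

theorem inner_newI (u v : E) : ⟪newI K u, v⟫_ℂ = -⟪u, newI K v⟫_ℂ := by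
  rw [newI, newI, inner_smul_left, inner_smul_right, inner_signOp, Complex.conj_I, neg_mul]

/-- Multiplication by `a + b i` with respect to the complex structure `j`: `a ψ + b j ψ`. -/
def newSmul (z : ℂ) (ψ : E) : E := (z.re : ℂ) • ψ + (z.im : ℂ) • newI K ψ

/-- The inner product belonging to the given norm and the complex structure `j` (by polarization). -/
def newInner (u v : E) : ℂ := ((⟪u, v⟫_ℂ).re : ℂ) - ((⟪u, newI K v⟫_ℂ).re : ℂ) * Complex.I

theorem newSmul_add (z : ℂ) (u v : E) : newSmul K z (u + v) = newSmul K z u + newSmul K z v := by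
  simp only [newSmul, newI_add]
  module

theorem add_newSmul (z w : ℂ) (u : E) : newSmul K (z + w) u = newSmul K z u + newSmul K w u := by
  simp only [newSmul, Complex.add_re, Complex.add_im]
  push_cast
  module

theorem mul_newSmul (z w : ℂ) (u : E) : newSmul K (z * w) u = newSmul K z (newSmul K w u) := by
  simp only [newSmul, newI_add, newI_smul, newI_newI, Complex.mul_re, Complex.mul_im]
  push_cast
  module

theorem re_inner_symm (u v : E) : (⟪u, v⟫_ℂ).re = (⟪v, u⟫_ℂ).re := by
  rw [← inner_conj_symm, Complex.conj_re]

theorem newInner_conj (u v : E) : starRingEnd ℂ (newInner K v u) = newInner K u v := by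
  have h : (⟪v, newI K u⟫_ℂ).re = -(⟪u, newI K v⟫_ℂ).re := by
    rw [re_inner_symm, inner_newI, Complex.neg_re]
  simp only [newInner, h, re_inner_symm v u, map_sub, map_mul, Complex.conj_ofReal, Complex.conj_I]
  push_cast
  ring

theorem newInner_add (u v w : E) : newInner K (u + v) w = newInner K u w + newInner K v w := by
  simp only [newInner, inner_add_left, Complex.add_re]
  push_cast
  ring

theorem newInner_smul (u v : E) (z : ℂ) :
    newInner K (newSmul K z u) v = starRingEnd ℂ z * newInner K u v := by
  have h : starRingEnd ℂ z = z.re - z.im * Complex.I := by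
    apply Complex.ext <;> simp
  simp only [newInner, newSmul, inner_add_left, inner_smul_left, inner_newI, newI_newI,
    inner_neg_right, Complex.conj_ofReal, Complex.add_re, Complex.re_ofReal_mul, Complex.neg_re, h]
  push_cast
  linear_combination (-(z.im * (⟪u, newI K v⟫_ℂ).re) : ℂ) * Complex.I_mul_I

theorem newInner_self (u : E) : newInner K u u = ((‖u‖ ^ 2 : ℝ) : ℂ) := by
  have h1 : (⟪u, newI K u⟫_ℂ).re = 0 := by
    have h : (⟪u, newI K u⟫_ℂ).re = -(⟪u, newI K u⟫_ℂ).re := by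
      rw [← Complex.neg_re, ← inner_newI, re_inner_symm]
    linarith
  have h2 : (⟪u, u⟫_ℂ).re = ‖u‖ ^ 2 := (norm_sq_eq_re_inner (𝕜 := ℂ) u).symm
  rw [newInner, h1, h2]
  simp

/-- The underlying set and norm of `E`, with the complex structure `j = newI K` in place of `i`. -/
def Twisted (_K : Submodule ℂ E) : Type _ := E

/-- The identity map from `E` to `Twisted K`. -/
def toTwisted (K : Submodule ℂ E) : E ≃ Twisted K := Equiv.refl E

instance : NormedAddCommGroup (Twisted K) := inferInstanceAs (NormedAddCommGroup E)

instance : Module ℂ (Twisted K) where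
  smul z u := toTwisted K (newSmul K z ((toTwisted K).symm u))
  one_smul u := by
    change newSmul K 1 ((toTwisted K).symm u) = (toTwisted K).symm u
    simp [newSmul]
  mul_smul z w u := mul_newSmul K z w ((toTwisted K).symm u)
  smul_zero z := by
    change newSmul K z (0 : E) = 0
    simp [newSmul, newI]
  smul_add z u v := newSmul_add K z ((toTwisted K).symm u) ((toTwisted K).symm v)
  add_smul z w u := add_newSmul K z w ((toTwisted K).symm u)
  zero_smul u := by
    change newSmul K 0 ((toTwisted K).symm u) = (0 : E)
    simp [newSmul]

theorem smul_toTwisted (z : ℂ) (ψ : E) :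
    z • toTwisted K ψ = toTwisted K ((z.re : ℂ) • ψ + (z.im : ℂ) • newI K ψ) := rfl

theorem norm_toTwisted (K : Submodule ℂ E) (ψ : E) : ‖toTwisted K ψ‖ = ‖ψ‖ := rfl

theorem norm_newSmul (z : ℂ) (u : E) : ‖newSmul K z u‖ = ‖z‖ * ‖u‖ := by
  have h1 : newInner K (newSmul K z u) (newSmul K z u) =
      starRingEnd ℂ z * (z * newInner K u u) := by
    rw [newInner_smul, ← newInner_conj, newInner_smul, map_mul, Complex.conj_conj, newInner_conj]
  rw [newInner_self, newInner_self, ← mul_assoc, Complex.conj_mul'] at h1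
  have h2 : ‖newSmul K z u‖ ^ 2 = (‖z‖ * ‖u‖) ^ 2 := by
    rw [mul_pow]
    exact_mod_cast h1
  exact (pow_left_inj₀ (norm_nonneg _) (by positivity) two_ne_zero).mp h2

instance : NormedSpace ℂ (Twisted K) where
  norm_smul_le z u := (norm_newSmul K z ((toTwisted K).symm u)).le

instance : InnerProductSpace ℂ (Twisted K) where
  inner u v := newInner K ((toTwisted K).symm u) ((toTwisted K).symm v)
  norm_sq_eq_re_inner u := by
    change ‖(toTwisted K).symm u‖ ^ 2 =
      (newInner K ((toTwisted K).symm u) ((toTwisted K).symm u)).re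
    rw [newInner_self, Complex.ofReal_re]
  conj_inner_symm u v := newInner_conj K ((toTwisted K).symm u) ((toTwisted K).symm v)
  add_left u v w := newInner_add K ((toTwisted K).symm u) ((toTwisted K).symm v)
    ((toTwisted K).symm w)
  smul_left u v z := newInner_smul K ((toTwisted K).symm u) ((toTwisted K).symm v) z

instance [CompleteSpace E] : CompleteSpace (Twisted K) := inferInstanceAs (CompleteSpace E)

end Twist

section Sphere

/-- The group SU(2), identified with the unit sphere `S³`. -/
abbrev SU2 : Type := Matrix.specialUnitaryGroup (Fin 2) ℂ

theorem isCompact_SU2 :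
    IsCompact (Matrix.specialUnitaryGroup (Fin 2) ℂ : Set (Matrix (Fin 2) (Fin 2) ℂ)) := by
  have hK : IsCompact (Set.univ.pi fun _ : Fin 2 => Set.univ.pi fun _ : Fin 2 =>
      Metric.closedBall (0 : ℂ) 1) :=
    isCompact_univ_pi fun _ => isCompact_univ_pi fun _ => isCompact_closedBall 0 1
  refine IsCompact.of_isClosed_subset hK ?_ ?_
  · have h : (Matrix.specialUnitaryGroup (Fin 2) ℂ : Set (Matrix (Fin 2) (Fin 2) ℂ)) =
        {A | A * star A = 1} ∩ {A | A.det = 1} := by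
      ext A
      simp only [SetLike.mem_coe, Matrix.mem_specialUnitaryGroup_iff, Matrix.mem_unitaryGroup_iff]
      rfl
    rw [h]
    refine (isClosed_eq ?_ continuous_const).inter (isClosed_eq ?_ continuous_const)
    · exact continuous_id.mul continuous_star
    · exact Continuous.matrix_det continuous_id
  · intro A hA
    exact fun i _ j _ => mem_closedBall_zero_iff.mpr
      (entry_norm_bound_of_unitary (Matrix.mem_specialUnitaryGroup_iff.mp hA).1 i j)

instance : CompactSpace SU2 := isCompact_iff_compactSpace.mp isCompact_SU2

instance : IsTopologicalGroup SU2 where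
  continuous_inv := by
    refine Continuous.subtype_mk (f := fun x : SU2 => star (x : Matrix (Fin 2) (Fin 2) ℂ)) ?_ _
    exact continuous_star.comp continuous_subtype_val

instance : MeasurableSpace SU2 := borel _

instance : BorelSpace SU2 := ⟨rfl⟩

/-- The invariant probability measure on SU(2): the volume measure of `S³`, normalized. -/
def sphereMeasure : Measure SU2 := Measure.haarMeasure ⊤

instance : sphereMeasure.IsHaarMeasure := inferInstanceAs (Measure.haarMeasure ⊤).IsHaarMeasure

instance : IsProbabilityMeasure sphereMeasure := ⟨Measure.haarMeasure_self⟩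

instance : sphereMeasure.IsMulRightInvariant where
  map_mul_right_eq_self g := by
    have : IsProbabilityMeasure (sphereMeasure.map (· * g)) :=
      Measure.isProbabilityMeasure_map (measurable_mul_const g).aemeasurable
    have : (sphereMeasure.map (· * g)).IsHaarMeasure := inferInstance
    exact Measure.isHaarMeasure_eq_of_isProbabilityMeasure _ _

/-- The Hilbert space `ℂ²`. -/
abbrev Spin : Type := EuclideanSpace ℂ (Fin 2)

/-- The space `L²(S³) ⊗ ℂ²` of square-integrable functions `S³ → ℂ²`. -/
abbrev HydrogenSpace : Type := Lp Spin 2 sphereMeasure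

theorem measurePreserving_translate (g : SU2 × SU2) :
    MeasurePreserving (fun x : SU2 => g.1⁻¹ * x * g.2) sphereMeasure sphereMeasure :=
  (measurePreserving_mul_right sphereMeasure g.2).comp
    (measurePreserving_mul_left sphereMeasure g.1⁻¹)

/-- The representation by left and right translations, `(R(g₁, g₂) ψ)(x) = ψ(g₁⁻¹ x g₂)`. -/
def translate (g : SU2 × SU2) : HydrogenSpace →ₗᵢ[ℂ] HydrogenSpace :=
  Lp.compMeasurePreservingₗᵢ ℂ (fun x : SU2 => g.1⁻¹ * x * g.2) (measurePreserving_translate g)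

theorem translate_ae (g : SU2 × SU2) (ψ : HydrogenSpace) :
    translate g ψ =ᵐ[sphereMeasure] fun x => ψ (g.1⁻¹ * x * g.2) :=
  Lp.coeFn_compMeasurePreserving ψ (measurePreserving_translate g)

/-- The operator `1 ⊗ M`, that is, `(M ψ)(x) = M (ψ x)`. -/
def spinOp (M : Matrix (Fin 2) (Fin 2) ℂ) : HydrogenSpace →L[ℂ] HydrogenSpace :=
  (Matrix.toEuclideanCLM (𝕜 := ℂ) M).compLpL 2 sphereMeasure

theorem spinOp_ae (M : Matrix (Fin 2) (Fin 2) ℂ) (ψ : HydrogenSpace) :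
    spinOp M ψ =ᵐ[sphereMeasure] fun x => Matrix.toEuclideanCLM (𝕜 := ℂ) M (ψ x) :=
  (Matrix.toEuclideanCLM (𝕜 := ℂ) M).coeFn_compLpL ψ

/-- The underlying map of the representation: `(ρ(g₁, g₂) ψ)(x) = g₂ (ψ(g₁⁻¹ x g₂))`. -/
def rhoFun (g : SU2 × SU2) (ψ : HydrogenSpace) : HydrogenSpace := spinOp g.2 (translate g ψ)

theorem rhoFun_ae (g : SU2 × SU2) (ψ : HydrogenSpace) :
    rhoFun g ψ =ᵐ[sphereMeasure]
      fun x => Matrix.toEuclideanCLM (𝕜 := ℂ) (g.2 : Matrix (Fin 2) (Fin 2) ℂ)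
        (ψ (g.1⁻¹ * x * g.2)) := by
  filter_upwards [spinOp_ae g.2 (translate g ψ), translate_ae g ψ] with x h1 h2
  rw [rhoFun, h1, h2]

theorem rhoFun_one (ψ : HydrogenSpace) : rhoFun 1 ψ = ψ := by
  apply Lp.ext
  filter_upwards [rhoFun_ae 1 ψ] with x h
  rw [h]
  simp

theorem rhoFun_mul (g h : SU2 × SU2) (ψ : HydrogenSpace) :
    rhoFun (g * h) ψ = rhoFun g (rhoFun h ψ) := by
  apply Lp.ext
  filter_upwards [rhoFun_ae (g * h) ψ, rhoFun_ae g (rhoFun h ψ),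
    (measurePreserving_translate g).quasiMeasurePreserving.ae_eq_comp (rhoFun_ae h ψ)] with x h1 h2 h3
  rw [h1, h2]
  simp only [Function.comp_apply] at h3
  rw [h3]
  simp [mul_assoc]

theorem norm_spin (g : SU2) (v : Spin) :
    ‖Matrix.toEuclideanCLM (𝕜 := ℂ) (g : Matrix (Fin 2) (Fin 2) ℂ) v‖ = ‖v‖ := by
  have hg : star (g : Matrix (Fin 2) (Fin 2) ℂ) * g = 1 :=
    Matrix.mem_unitaryGroup_iff'.mp (Matrix.mem_specialUnitaryGroup_iff.mp g.2).1
  have h : Matrix.toEuclideanCLM (𝕜 := ℂ) (g : Matrix (Fin 2) (Fin 2) ℂ) ∈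
      unitary (Spin →L[ℂ] Spin) := by
    rw [Unitary.mem_iff, ← map_star, ← map_mul, ← map_mul, hg,
      Matrix.mem_unitaryGroup_iff.mp (Matrix.mem_specialUnitaryGroup_iff.mp g.2).1, map_one]
    exact ⟨rfl, rfl⟩
  exact ContinuousLinearMap.norm_map_of_mem_unitary h v

theorem norm_rhoFun (g : SU2 × SU2) (ψ : HydrogenSpace) : ‖rhoFun g ψ‖ = ‖ψ‖ := by
  rw [← (translate g).norm_map ψ, Lp.norm_def, Lp.norm_def]
  congr 1
  refine eLpNorm_congr_norm_ae ?_
  filter_upwards [spinOp_ae g.2 (translate g ψ)] with x hx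
  rw [rhoFun, hx, norm_spin]

/-- The unitary representation `ρ` of SU(2) × SU(2) on `L²(S³) ⊗ ℂ²`. -/
def rho : SU2 × SU2 →* (HydrogenSpace ≃ₗᵢ[ℂ] HydrogenSpace) where
  toFun g :=
    { toFun := rhoFun g
      invFun := rhoFun g⁻¹
      map_add' := fun x y => by simp only [rhoFun, map_add]
      map_smul' := fun c x => by simp only [rhoFun, map_smul, RingHom.id_apply]
      left_inv := fun x => by rw [← rhoFun_mul, inv_mul_cancel, rhoFun_one]
      right_inv := fun x => by rw [← rhoFun_mul, mul_inv_cancel, rhoFun_one]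
      norm_map' := norm_rhoFun g }
  map_one' := LinearIsometryEquiv.ext rhoFun_one
  map_mul' g h := LinearIsometryEquiv.ext (rhoFun_mul g h)

theorem rho_ae (g : SU2 × SU2) (ψ : HydrogenSpace) :
    rho g ψ =ᵐ[sphereMeasure]
      fun x => Matrix.toEuclideanCLM (𝕜 := ℂ) (g.2 : Matrix (Fin 2) (Fin 2) ℂ)
        (ψ (g.1⁻¹ * x * g.2)) := rhoFun_ae g ψ

theorem translate_inv (g : SU2 × SU2) (ψ : HydrogenSpace) : translate g (translate g⁻¹ ψ) = ψ := by
  apply Lp.ext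
  filter_upwards [translate_ae g (translate g⁻¹ ψ),
    (measurePreserving_translate g).quasiMeasurePreserving.ae_eq_comp (translate_ae g⁻¹ ψ)]
    with x h1 h2
  rw [h1]
  simp only [Function.comp_apply] at h2
  rw [h2]
  simp [mul_assoc]

/-- Right translation as a unitary operator: `(rightTranslate h ψ)(x) = ψ(x h)`. -/
def rightTranslate (h : SU2) : HydrogenSpace ≃ₗᵢ[ℂ] HydrogenSpace where
  toFun := translate (1, h)
  map_add' := map_add _
  map_smul' := map_smul _
  invFun := translate (1, h)⁻¹
  left_inv ψ := by simpa using translate_inv (1, h)⁻¹ ψ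
  right_inv ψ := translate_inv (1, h) ψ
  norm_map' := (translate (1, h)).norm_map

end Sphere

section Dirac

/-- The Pauli matrices. -/
def pauli : Fin 3 → Matrix (Fin 2) (Fin 2) ℂ :=
  ![!![0, 1; 1, 0], !![0, -Complex.I; Complex.I, 0], !![1, 0; 0, -1]]

/-- The matrix `exp(i t σⱼ / 2) = cos(t / 2) + i sin(t / 2) σⱼ`. -/
def pauliExp (j : Fin 3) (t : ℝ) : Matrix (Fin 2) (Fin 2) ℂ :=
  (Real.cos (t / 2) : ℂ) • (1 : Matrix (Fin 2) (Fin 2) ℂ) +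
    (Complex.I * (Real.sin (t / 2) : ℂ)) • pauli j

theorem pauliExp_mem (j : Fin 3) (t : ℝ) :
    pauliExp j t ∈ Matrix.specialUnitaryGroup (Fin 2) ℂ := by
  have h : (Real.cos (t / 2) : ℂ) ^ 2 + (Real.sin (t / 2) : ℂ) ^ 2 = 1 := by
    exact_mod_cast Real.cos_sq_add_sin_sq (t / 2)
  rw [Matrix.mem_specialUnitaryGroup_iff, Matrix.mem_unitaryGroup_iff]
  unfold pauliExp
  generalize Real.cos (t / 2) = c at h ⊢
  generalize Real.sin (t / 2) = s at h ⊢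
  have hI : Complex.I ^ 2 = -1 := Complex.I_sq
  constructor
  · fin_cases j <;> ext a b <;> fin_cases a <;> fin_cases b <;>
      simp [pauli, Matrix.mul_apply, Fin.sum_univ_two, Matrix.star_apply] <;> grind
  · fin_cases j <;> simp [pauli, Matrix.det_fin_two] <;> grind

/-- The self-adjoint generator `Bⱼ` of right translations:
`(exp(i t Bⱼ) ψ)(x) = ψ(x exp(i t σⱼ / 2))`. -/
def rightGen (j : Fin 3) : HydrogenSpace →ₗ.[ℂ] HydrogenSpace :=
  stoneGenerator fun t => rightTranslate ⟨pauliExp j t, pauliExp_mem j t⟩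

/-- The Dirac operator on spinors on the unit 3-sphere, `4 ∑ⱼ Bⱼ Sⱼ + 3/2` with `Sⱼ = 1 ⊗ σⱼ / 2`,
with domain the common domain of the operators `Bⱼ` (the Sobolev space `H¹`). In terms of the left-invariant
unit vector fields `Xⱼ = -2 i Bⱼ` this is `∑ⱼ i Xⱼ ⊗ σⱼ + 3/2`. -/
def dirac : HydrogenSpace →ₗ.[ℂ] HydrogenSpace :=
  diracOf rightGen fun j => spinOp ((1 / 2 : ℂ) • pauli j)

/-- The closed span of the eigenvectors of the Dirac operator with positive eigenvalue. -/
abbrev positiveSpace : Submodule ℂ HydrogenSpace := eigenSpan dirac (Set.Ioi 0)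

/-- The closed span of the eigenvectors of the Dirac operator with negative eigenvalue. -/
abbrev negativeSpace : Submodule ℂ HydrogenSpace := eigenSpan dirac (Set.Iio 0)

/-- The Hilbert space of the left-handed Weyl equation on the Einstein universe: `L²(S³) ⊗ ℂ²` with
the same norm and with complex structure `-i` on the negative-frequency solutions and `i` on their
orthogonal complement. -/
abbrev WeylSpace : Type := Twisted negativeSpace

/-- The identity map from `L²(S³) ⊗ ℂ²` to the Hilbert space of the Weyl equation. -/
abbrev toWeyl : HydrogenSpace ≃ WeylSpace := toTwisted negativeSpace

/-- The conjugate-linear map `v ↦ ε v̄` on `ℂ²`. -/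
def spinConj : Spin →L⋆[ℂ] Spin where
  toFun v := WithLp.toLp 2 (!![0, 1; -1, 0] *ᵥ fun i => starRingEnd ℂ (v i))
  map_add' u v := by
    ext i
    fin_cases i <;> simp [Matrix.mulVec, dotProduct, Fin.sum_univ_two, add_comm]
  map_smul' c v := by
    ext i
    fin_cases i <;> simp [Matrix.mulVec, dotProduct, Fin.sum_univ_two]
  cont := by fun_prop

/-- The conjugate-linear map `C` on `L²(S³) ⊗ ℂ²`, `(C ψ)(x) = ε (conjugate of ψ(x))`. -/
def chargeConj : HydrogenSpace →L⋆[ℂ] HydrogenSpace := spinConj.compLpL 2 sphereMeasure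

end Dirac

end

end KeplerFock

open KeplerFock

/-! Algebraically the theorem rests on two facts. First, $C$ is antilinear and the new complex
structure is $-i$ on the negative spectral subspace, so $F = I(p_+ + Cp_-)$ is complex-linear into
$\mathcal H$. Second, $C$ commutes with $\rho$, because $\epsilon\bar g = g\epsilon$ on SU(2), and
with $D$, because $C$ anticommutes with each $B_j$ and each $S_j$ (`chargeConj_rho`,
`chargeConj_mem_graph_dirac`). Hence $C$ preserves the spectral subspaces, and $F$ is a
norm-preserving bijection with inverse built from $p_+ - Cp_-$, intertwining $\rho$ and $D$ with
their counterparts on $\mathcal H$. Since $\Lambda$ is functorial, $\Lambda(F)$ conjugates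
$\Lambda(\rho)$ and the groups $\Lambda(e^{itD})$, and therefore their generators
(`mem_graph_dFock`).

The analytic work is to show that $D$, on the common domain of the $B_j$, generates a unitary group
and that its positive and negative eigenspaces span. Spinors with polynomial entries in the matrix
coefficients are dense by Stone–Weierstrass. $D$ is symmetric and does not raise their degree, so
diagonalization in finite dimension gives an orthonormal eigenbasis of polynomial spinors
(`exists_dirac_eigenbasis`).

Let $T = D - \frac32 = 4\sum B_jS_j$. The su(2) relations give $4\sum B_j^2 = T^2 + 2T$
(`four_casimir`), which is used twice. It excludes the eigenvalue $0$, since $T = -\frac32$ would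
make $4\sum\|B_jf\|^2$ negative; so $p_+ + p_- = 1$. It also bounds each $\|B_jf\|$ by $\|Df\|$ and
$\|f\|$ (`norm_polyGen_le`), so graph limits of polynomials stay in the common domain, and $D$ is
exactly the maximal diagonal operator of its eigenbasis (`stoneGenerator_diagGroup_eq`). Polynomial
spinors are thus a core, on which commutation of $D$ with $\rho$ is checked algebraically:
$\sum\sigma_j\otimes\sigma_j$ is twice the flip minus the identity, and the flip commutes with
$h\otimes h$. -/

namespace KeplerFock

/-! ### Generators of one-parameter unitary groups, through their graphs -/

section Generators

variable {E : Type*} [NormedAddCommGroup E] [InnerProductSpace ℂ E]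
variable {E' : Type*} [NormedAddCommGroup E'] [InnerProductSpace ℂ E']

/-- Working with graphs keeps proofs of domain membership out of later statements; equality of
unbounded operators, domains included, becomes an equivalence of memberships. -/
theorem mem_graph_stoneGenerator {U : ℝ → (E ≃ₗᵢ[ℂ] E)} {x y : E} :
    (x, y) ∈ (stoneGenerator U).graph ↔ HasDerivAt (fun t => U t x) (Complex.I • y) 0 := by
  rw [LinearPMap.mem_graph_iff]
  constructor
  · rintro ⟨⟨z, hz⟩, rfl, h⟩
    change DifferentiableAt ℝ (fun t => U t z) 0 at hz
    change -Complex.I • deriv (fun t => U t z) 0 = y at h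
    rw [← h, smul_smul]
    simpa using hz.hasDerivAt
  · intro h
    refine ⟨⟨x, h.differentiableAt⟩, rfl, ?_⟩
    change -Complex.I • deriv (fun t => U t x) 0 = y
    rw [h.deriv, smul_smul]
    simp

/-- A one-parameter group of unitary operators, without any continuity. -/
structure IsOneParam (U : ℝ → (E ≃ₗᵢ[ℂ] E)) : Prop where
  zero : U 0 = 1
  add : ∀ s t, U (s + t) = U s * U t

theorem IsUnitaryGroupOf.isOneParam {A : E →ₗ.[ℂ] E} {U : ℝ → (E ≃ₗᵢ[ℂ] E)}
    (h : IsUnitaryGroupOf A U) : IsOneParam U := ⟨h.zero, h.add⟩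

variable {U : ℝ → (E ≃ₗᵢ[ℂ] E)}

theorem IsOneParam.add_apply (hU : IsOneParam U) (s t : ℝ) (x : E) : U (s + t) x = U s (U t x) := by
  rw [hU.add]; rfl

/-- The group law carries the derivative at $0$ to time $t$: $U(s)x = U(t)U(s-t)x$ with $U(t)$
bounded. Strong continuity is not needed. -/
theorem IsOneParam.hasDerivAt (hU : IsOneParam U) {x y : E}
    (h : (x, y) ∈ (stoneGenerator U).graph) (t : ℝ) :
    HasDerivAt (fun t => U t x) (U t (Complex.I • y)) t := by
  rw [mem_graph_stoneGenerator] at h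
  have h1 : HasDerivAt (fun s => U (s - t) x) (Complex.I • y) t :=
    HasDerivAt.comp_sub_const t t (by simpa using h)
  have h2 := ((U t).toContinuousLinearEquiv.toContinuousLinearMap.restrictScalars
    ℝ).hasFDerivAt.comp_hasDerivAt t h1
  refine h2.congr_of_eventuallyEq (Filter.Eventually.of_forall fun s => ?_)
  change U s x = U t (U (s - t) x)
  rw [← hU.add_apply, add_sub_cancel]

theorem IsOneParam.graph_invariant (hU : IsOneParam U) {x y : E}
    (h : (x, y) ∈ (stoneGenerator U).graph) (t : ℝ) :
    (U t x, U t y) ∈ (stoneGenerator U).graph := by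
  rw [mem_graph_stoneGenerator]
  have := hU.hasDerivAt h t
  rw [← zero_add t] at this
  have h1 := this.comp_add_const 0 t
  rw [zero_add, map_smul] at h1
  refine h1.congr_of_eventuallyEq (Filter.Eventually.of_forall fun s => ?_)
  change U s (U t x) = U (s + t) x
  rw [← hU.add_apply]

/-- Differentiate the constant function $\langle U(t)x, U(t)x'\rangle$ at $0$. -/
theorem IsOneParam.symmetric (hU : IsOneParam U) {x y x' y' : E}
    (h : (x, y) ∈ (stoneGenerator U).graph) (h' : (x', y') ∈ (stoneGenerator U).graph) :
    ⟪y, x'⟫_ℂ = ⟪x, y'⟫_ℂ := by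
  rw [mem_graph_stoneGenerator] at h h'
  have h1 := h.inner ℂ h'
  have h2 : (fun t => ⟪U t x, U t x'⟫_ℂ) = fun _ => ⟪x, x'⟫_ℂ := by
    ext t; exact (U t).inner_map_map x x'
  rw [h2, hU.zero] at h1
  have h3 := h1.unique (hasDerivAt_const 0 _)
  simp only [LinearIsometryEquiv.coe_one, id, inner_smul_left, inner_smul_right,
    Complex.conj_I] at h3
  have h4 : Complex.I * (⟪x, y'⟫_ℂ - ⟪y, x'⟫_ℂ) = 0 := by linear_combination h3
  exact (sub_eq_zero.mp ((mul_eq_zero.mp h4).resolve_left Complex.I_ne_zero)).symm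

/-- The generator is closed: because each $U(t)$ is isometric, the derivatives $U(t)(iy_k)$ converge
uniformly in $t$, and limits and derivatives may be exchanged. -/
theorem IsOneParam.closed (hU : IsOneParam U) {ι : Type*} {l : Filter ι} [l.NeBot]
    {x y : ι → E} {x₀ y₀ : E} (h : ∀ i, (x i, y i) ∈ (stoneGenerator U).graph)
    (hx : Filter.Tendsto x l (nhds x₀)) (hy : Filter.Tendsto y l (nhds y₀)) :
    (x₀, y₀) ∈ (stoneGenerator U).graph := by
  rw [mem_graph_stoneGenerator]
  have key : HasDerivAt (fun t => U t x₀) (U 0 (Complex.I • y₀)) 0 := by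
    refine hasDerivAt_of_tendstoUniformly (l := l) (f := fun i t => U t (x i))
      (f' := fun i t => U t (Complex.I • y i)) (g' := fun t => U t (Complex.I • y₀)) ?_ ?_ ?_ 0
    · rw [Metric.tendstoUniformly_iff]
      intro ε hε
      filter_upwards [Metric.tendsto_nhds.mp hy ε hε] with i hi t
      rw [(U t).dist_map, dist_eq_norm, ← smul_sub, norm_smul, Complex.norm_I, one_mul,
        ← dist_eq_norm, dist_comm]
      exact hi
    · exact Filter.Eventually.of_forall fun i t => hU.hasDerivAt (h i) t
    · exact fun t => ((U t).continuous.tendsto x₀).comp hx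
  simpa [hU.zero] using key

/-- A bounded real-linear operator commuting with a unitary group acts on the graph of the generator. -/
theorem mem_graph_stoneGenerator_of_commute (L : E →L[ℝ] E) (hL : ∀ t x, U t (L x) = L (U t x))
    {x y y' : E} (h : (x, y) ∈ (stoneGenerator U).graph) (hy : Complex.I • y' = L (Complex.I • y)) :
    (L x, y') ∈ (stoneGenerator U).graph := by
  rw [mem_graph_stoneGenerator] at h ⊢
  simp only [hL, hy]
  exact L.hasFDerivAt.comp_hasDerivAt 0 h

theorem graph_snd_unique {A : E →ₗ.[ℂ] E} {x y z : E} (h : (x, y) ∈ A.graph)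
    (h' : (x, z) ∈ A.graph) : y = z :=
  LinearPMap.mem_graph_snd_inj A h h' rfl

/-- The vectors on which a family of isometries is continuous. -/
def continuousVectors {X : Type*} [TopologicalSpace X] (U : X → (E ≃ₗᵢ[ℂ] E)) : Submodule ℂ E where
  carrier := {x | Continuous fun t => U t x}
  add_mem' := fun {x y} hx hy => by
    simp only [Set.mem_ofPred_eq, map_add] at hx hy ⊢
    exact hx.add hy
  zero_mem' := by simpa using continuous_const
  smul_mem' := fun c x hx => by
    simp only [Set.mem_ofPred_eq, map_smul] at hx ⊢
    exact hx.const_smul c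

theorem isClosed_continuousVectors {X : Type*} [TopologicalSpace X] (U : X → (E ≃ₗᵢ[ℂ] E)) :
    IsClosed (continuousVectors U : Set E) := by
  rw [← isSeqClosed_iff_isClosed]
  intro x x₀ hx h
  change Continuous fun t => U t x₀
  refine TendstoUniformly.continuous (F := fun n t => U t (x n)) (p := Filter.atTop) ?_
    (Filter.Frequently.of_forall hx)
  rw [Metric.tendstoUniformly_iff]
  intro ε hε
  filter_upwards [Metric.tendsto_nhds.mp h ε hε] with i hi t
  rwa [(U t).dist_map, dist_comm]

theorem continuous_of_dense {X : Type*} [TopologicalSpace X] (U : X → (E ≃ₗᵢ[ℂ] E)) {s : Set E}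
    (hs : Dense (Submodule.span ℂ s : Set E)) (h : ∀ x ∈ s, Continuous fun t => U t x) (x : E) :
    Continuous fun t => U t x := by
  have h1 : (Submodule.span ℂ s : Set E) ⊆ continuousVectors U := Submodule.span_le.mpr h
  have h2 := (isClosed_continuousVectors U).closure_subset_iff.mpr h1
  exact h2 (hs x)

/-- For $x$ in the domain, $z(t) = U(t)x - V(t)x$ solves $z' = iAz$; symmetry of $A$ makes $\|z\|^2$
constant, and $z(0)=0$. Density of the domain does the rest. -/
theorem IsUnitaryGroupOf.unique {A : E →ₗ.[ℂ] E} (hA : Dense (A.domain : Set E))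
    {U V : ℝ → (E ≃ₗᵢ[ℂ] E)} (hU : IsUnitaryGroupOf A U) (hV : IsUnitaryGroupOf A V) :
    U = V := by
  ext t x
  refine congrFun (Continuous.ext_on hA (U t).continuous (V t).continuous fun x hx => ?_) x
  obtain ⟨y, hxy⟩ := LinearPMap.mem_domain_iff.mp hx
  have hgU : ∀ t, (U t x, U t y) ∈ A.graph := fun t => by
    have := hU.isOneParam.graph_invariant (by rw [hU.generator]; exact hxy) t
    rwa [hU.generator] at this
  have hgV : ∀ t, (V t x, V t y) ∈ A.graph := fun t => by
    have := hV.isOneParam.graph_invariant (by rw [hV.generator]; exact hxy) t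
    rwa [hV.generator] at this
  have hd : ∀ t, HasDerivAt (fun t => U t x - V t x) (Complex.I • (U t y - V t y)) t := fun t => by
    rw [smul_sub, ← map_smul, ← map_smul]
    exact (hU.isOneParam.hasDerivAt (by rwa [hU.generator]) t).sub
      (hV.isOneParam.hasDerivAt (by rwa [hV.generator]) t)
  have hd2 : ∀ t, HasDerivAt (fun t => ⟪U t x - V t x, U t x - V t x⟫_ℂ) 0 t := fun t => by
    have h := (hd t).inner ℂ (hd t)
    have hs : (U t x - V t x, U t y - V t y) ∈ (stoneGenerator U).graph := by
      rw [hU.generator]; exact A.graph.sub_mem (hgU t) (hgV t)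
    have := hU.isOneParam.symmetric hs hs
    rw [inner_smul_left, inner_smul_right, this, Complex.conj_I, ← add_mul, add_neg_cancel,
      zero_mul] at h
    exact h
  have h0 := is_const_of_deriv_eq_zero (fun t => (hd2 t).differentiableAt)
    (fun t => (hd2 t).deriv) t 0
  rw [hU.zero, hV.zero, sub_self, inner_zero_left, inner_self_eq_zero, sub_eq_zero] at h0
  exact h0

theorem eq_of_graph_iff {A B : E →ₗ.[ℂ] E}
    (h : ∀ x y, (x, y) ∈ A.graph ↔ (x, y) ∈ B.graph) : A = B :=
  LinearPMap.eq_of_eq_graph (by ext ⟨x, y⟩; exact h x y)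

theorem mem_graph_stoneGenerator_conj (U : ℝ → (E ≃ₗᵢ[ℂ] E)) (F : E ≃ₗᵢ[ℂ] E') {x y : E} :
    (F x, F y) ∈ (stoneGenerator fun t => (F.symm.trans (U t)).trans F).graph ↔
      (x, y) ∈ (stoneGenerator U).graph := by
  rw [mem_graph_stoneGenerator, mem_graph_stoneGenerator]
  simp only [LinearIsometryEquiv.trans_apply, LinearIsometryEquiv.symm_apply_apply]
  constructor
  · intro hd
    have := (F.symm.toContinuousLinearEquiv.toContinuousLinearMap.restrictScalars
      ℝ).hasFDerivAt.comp_hasDerivAt 0 hd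
    simpa [Function.comp_def] using this
  · intro hd
    have := (F.toContinuousLinearEquiv.toContinuousLinearMap.restrictScalars
      ℝ).hasFDerivAt.comp_hasDerivAt 0 hd
    simpa [Function.comp_def] using this

/-- Transport of a one-parameter unitary group by a unitary operator. -/
theorem IsUnitaryGroupOf.conj {A : E →ₗ.[ℂ] E} (hU : IsUnitaryGroupOf A U) {B : E' →ₗ.[ℂ] E'}
    (F : E ≃ₗᵢ[ℂ] E') (h : ∀ x y, (F x, F y) ∈ B.graph ↔ (x, y) ∈ A.graph) :
    IsUnitaryGroupOf B fun t => (F.symm.trans (U t)).trans F where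
  zero := by ext x; simp [hU.zero]
  add s t := by ext x; simp [hU.add]
  continuous x := F.continuous.comp (hU.continuous (F.symm x))
  generator := by
    refine eq_of_graph_iff fun x y => ?_
    obtain ⟨x, rfl⟩ := F.surjective x
    obtain ⟨y, rfl⟩ := F.surjective y
    rw [h, ← hU.generator, mem_graph_stoneGenerator_conj]

theorem unitaryGroup_spec {A : E →ₗ.[ℂ] E} (h : IsUnitaryGroupOf A U) :
    IsUnitaryGroupOf A (unitaryGroup A) :=
  Classical.epsilon_spec ⟨U, h⟩

/-- `unitaryGroup` is an arbitrary choice among the groups with a given generator, so identifying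
the chosen group of `B` with the transported one requires uniqueness, hence density of the domain.
-/
theorem unitaryGroup_conj {A : E →ₗ.[ℂ] E} (hU : IsUnitaryGroupOf A (unitaryGroup A))
    (hA : Dense (A.domain : Set E)) {B : E' →ₗ.[ℂ] E'}
    (F : E ≃ₗᵢ[ℂ] E') (h : ∀ x y, (F x, F y) ∈ B.graph ↔ (x, y) ∈ A.graph) (t : ℝ) :
    unitaryGroup B t = (F.symm.trans (unitaryGroup A t)).trans F := by
  have h1 := hU.conj F h
  refine congrFun (IsUnitaryGroupOf.unique ?_ (unitaryGroup_spec h1) h1) t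
  have h2 : Dense (F '' A.domain) := F.surjective.denseRange.dense_image F.continuous hA
  refine h2.mono ?_
  rintro _ ⟨x, hx, rfl⟩
  obtain ⟨y, hy⟩ := LinearPMap.mem_domain_iff.mp hx
  exact LinearPMap.mem_domain_iff.mpr ⟨F y, (h x y).mpr hy⟩

end Generators

/-! ### Unitary groups diagonal in a Hilbert basis -/

section DiagonalGroup

variable {E : Type*} [NormedAddCommGroup E] [InnerProductSpace ℂ E]
variable {ι : Type*} (b : HilbertBasis ι ℂ E) (l : ι → ℝ)

theorem _root_.HilbertBasis.ext_inner {b : HilbertBasis ι ℂ E} {x y : E}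
    (h : ∀ k, ⟪b k, x⟫_ℂ = ⟪b k, y⟫_ℂ) : x = y := by
  apply b.repr.injective
  ext k
  rw [b.repr_apply_apply, b.repr_apply_apply, h]

theorem dense_span_basis : Dense (Submodule.span ℂ (Set.range b) : Set E) := by
  rw [Submodule.dense_iff_topologicalClosure_eq_top]
  exact b.dense_span

/-- The phase `exp(i t l)`. -/
noncomputable def phase (t l : ℝ) : ℂ := Complex.exp ((t * l : ℝ) * Complex.I)

theorem conj_phase_mul (t l : ℝ) : starRingEnd ℂ (phase t l) * phase t l = 1 := by
  rw [Complex.conj_mul', phase, Complex.norm_exp_ofReal_mul_I]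
  simp

theorem phase_zero (l : ℝ) : phase 0 l = 1 := by simp [phase]

theorem phase_add (s t l : ℝ) : phase (s + t) l = phase s l * phase t l := by
  rw [phase, phase, phase, ← Complex.exp_add]
  congr 1
  push_cast
  ring

theorem hasDerivAt_phase (l : ℝ) : HasDerivAt (fun t => phase t l) (Complex.I * l) 0 := by
  have h : HasDerivAt (fun t : ℝ => ((t * l : ℝ) : ℂ) * Complex.I) (((1 * l : ℝ) : ℂ) * Complex.I) 0 :=
    (((hasDerivAt_id (0 : ℝ)).mul_const l).ofReal_comp).mul_const Complex.I
  have h2 := h.cexp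
  rw [show Complex.exp (((0 * l : ℝ) : ℂ) * Complex.I) * (((1 * l : ℝ) : ℂ) * Complex.I) =
    Complex.I * l by simp [mul_comm]] at h2
  exact h2

theorem continuous_phase (l : ℝ) : Continuous fun t => phase t l := by
  unfold phase; fun_prop

theorem orthonormal_phase (t : ℝ) : Orthonormal ℂ fun k => phase t (l k) • b k := by
  classical
  rw [orthonormal_iff_ite]
  intro i j
  rw [inner_smul_left, inner_smul_right, orthonormal_iff_ite.mp b.orthonormal i j]
  split_ifs with h
  · subst h; rw [mul_one, conj_phase_mul]
  · simp

variable [CompleteSpace E]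

/-- The Hilbert basis `exp(i t lₖ) bₖ`. -/
noncomputable def phaseBasis (t : ℝ) : HilbertBasis ι ℂ E :=
  HilbertBasis.mk (orthonormal_phase b l t) <| by
    rw [← b.dense_span]
    refine Submodule.topologicalClosure_mono (Submodule.span_le.mpr ?_)
    rintro _ ⟨k, rfl⟩
    have h : b k = starRingEnd ℂ (phase t (l k)) • phase t (l k) • b k := by
      rw [smul_smul, conj_phase_mul, one_smul]
    rw [h]
    exact Submodule.smul_mem _ _ (Submodule.subset_span ⟨k, rfl⟩)

theorem phaseBasis_apply (t : ℝ) (k : ι) : phaseBasis b l t k = phase t (l k) • b k := by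
  rw [phaseBasis, HilbertBasis.coe_mk]

/-- The unitary group with `U(t) bₖ = exp(i t lₖ) bₖ`. -/
noncomputable def diagGroup (t : ℝ) : E ≃ₗᵢ[ℂ] E := b.repr.trans (phaseBasis b l t).repr.symm

theorem inner_diagGroup (t : ℝ) (k : ι) (x : E) :
    ⟪b k, diagGroup b l t x⟫_ℂ = phase t (l k) * ⟪b k, x⟫_ℂ := by
  have h : ⟪phaseBasis b l t k, diagGroup b l t x⟫_ℂ = ⟪b k, x⟫_ℂ := by
    rw [← HilbertBasis.repr_apply_apply, ← HilbertBasis.repr_apply_apply, diagGroup]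
    simp
  rw [phaseBasis_apply, inner_smul_left] at h
  rw [← h, ← mul_assoc, mul_comm (phase t (l k)), conj_phase_mul, one_mul]

theorem diagGroup_basis (t : ℝ) (k : ι) : diagGroup b l t (b k) = phase t (l k) • b k := by
  classical
  refine HilbertBasis.ext_inner (b := b) fun i => ?_
  rw [inner_diagGroup, inner_smul_right, orthonormal_iff_ite.mp b.orthonormal i k]
  split_ifs with h
  · rw [h]
  · simp

theorem isOneParam_diagGroup : IsOneParam (diagGroup b l) where
  zero := by
    ext x
    refine HilbertBasis.ext_inner (b := b) fun i => ?_
    rw [inner_diagGroup, phase_zero, one_mul]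
    rfl
  add s t := by
    ext x
    refine HilbertBasis.ext_inner (b := b) fun i => ?_
    change _ = ⟪b i, diagGroup b l s (diagGroup b l t x)⟫_ℂ
    rw [inner_diagGroup, inner_diagGroup, inner_diagGroup, phase_add, mul_assoc]

theorem continuous_diagGroup (x : E) : Continuous fun t => diagGroup b l t x := by
  refine continuous_of_dense (diagGroup b l) (dense_span_basis b) ?_ x
  rintro _ ⟨k, rfl⟩
  simp only [diagGroup_basis]
  exact (continuous_phase _).smul continuous_const

theorem basis_mem_graph (k : ι) : (b k, (l k : ℂ) • b k) ∈ (stoneGenerator (diagGroup b l)).graph := by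
  rw [mem_graph_stoneGenerator]
  simp only [diagGroup_basis]
  rw [smul_smul]
  exact (hasDerivAt_phase (l k)).smul_const (b k)

theorem sum_basis_mem_graph (s : Finset ι) (c : ι → ℂ) :
    (∑ k ∈ s, c k • b k, ∑ k ∈ s, c k • (l k : ℂ) • b k) ∈
      (stoneGenerator (diagGroup b l)).graph := by
  have h := Submodule.sum_mem (stoneGenerator (diagGroup b l)).graph (t := s)
    (f := fun k => c k • ((b k, (l k : ℂ) • b k) : E × E))
    fun k _ => Submodule.smul_mem _ _ (basis_mem_graph b l k)
  convert h using 1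
  simp [Prod.ext_iff, Prod.fst_sum, Prod.snd_sum]

/-- The generator is the maximal multiplication operator by the $l_k$. One direction is symmetry
tested against the basis; in the other, the partial sums of the expansions of $x$ and $y$ are in the
graph, which is closed. -/
theorem mem_graph_diagGroup {x y : E} :
    (x, y) ∈ (stoneGenerator (diagGroup b l)).graph ↔ ∀ k, ⟪b k, y⟫_ℂ = l k * ⟪b k, x⟫_ℂ := by
  constructor
  · intro h k
    rw [← (isOneParam_diagGroup b l).symmetric (basis_mem_graph b l k) h, inner_smul_left,
      Complex.conj_ofReal]
  · intro h
    refine (isOneParam_diagGroup b l).closed (l := Filter.atTop)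
      (fun s : Finset ι => sum_basis_mem_graph b l s fun k => ⟪b k, x⟫_ℂ) ?_ ?_
    · simpa only [HasSum, SummationFilter.unconditional_filter, b.repr_apply_apply] using b.hasSum_repr x
    · have h2 := b.hasSum_repr y
      simp only [HasSum, SummationFilter.unconditional_filter, b.repr_apply_apply, h] at h2
      simpa only [smul_smul, mul_comm] using h2

end DiagonalGroup

/-! ### Eigenbases from finite-dimensional invariant subspaces -/

section EigenBasis

variable {E : Type*} [NormedAddCommGroup E] [InnerProductSpace ℂ E]

/-- A symmetric operator with an increasing sequence of finite-dimensional invariant subspaces in its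
domain has an orthonormal eigenbasis in every one of them. -/
theorem exists_orthonormal_eigenbasis {A : E →ₗ.[ℂ] E}
    (hA : ∀ {x y x' y'}, (x, y) ∈ A.graph → (x', y') ∈ A.graph → ⟪y, x'⟫_ℂ = ⟪x, y'⟫_ℂ)
    (W : Submodule ℂ E) [FiniteDimensional ℂ W] (hW : ∀ x ∈ W, ∃ y ∈ W, (x, y) ∈ A.graph) :
    ∃ (n : ℕ) (v : OrthonormalBasis (Fin n) ℂ W) (l : Fin n → ℝ),
      ∀ k, ((v k : E), (l k : ℂ) • (v k : E)) ∈ A.graph := by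
  choose f hf hg using hW
  let T : W →ₗ[ℂ] W :=
    { toFun := fun x => ⟨f x x.2, hf x x.2⟩
      map_add' := fun x y => Subtype.ext
        (graph_snd_unique (hg _ (x + y).2) (A.graph.add_mem (hg x x.2) (hg y y.2)))
      map_smul' := fun c x => Subtype.ext
        (graph_snd_unique (hg _ (c • x).2) (A.graph.smul_mem c (hg x x.2))) }
  have hT : T.IsSymmetric := fun x y => hA (hg x x.2) (hg y y.2)
  refine ⟨_, hT.eigenvectorBasis rfl, hT.eigenvalues rfl, fun k => ?_⟩
  have h := hg _ (hT.eigenvectorBasis rfl k).2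
  have h2 := congrArg Subtype.val (hT.apply_eigenvectorBasis rfl k)
  change f _ _ = _ at h2
  rw [h2] at h
  exact h

theorem exists_hilbertBasis_eigen [CompleteSpace E] {A : E →ₗ.[ℂ] E}
    (hA : ∀ {x y x' y'}, (x, y) ∈ A.graph → (x', y') ∈ A.graph → ⟪y, x'⟫_ℂ = ⟪x, y'⟫_ℂ)
    (V : ℕ → Submodule ℂ E) (hV : Monotone V) [∀ n, FiniteDimensional ℂ (V n)]
    (hAV : ∀ n, ∀ x ∈ V n, ∃ y ∈ V n, (x, y) ∈ A.graph)
    (hd : (⨆ n, V n).topologicalClosure = ⊤) :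
    ∃ (ι : Type) (b : HilbertBasis ι ℂ E) (l : ι → ℝ),
      (∀ k, (b k, (l k : ℂ) • b k) ∈ A.graph) ∧ ∀ k, ∃ n, b k ∈ V n := by
  -- `P n` is the predecessor of `V n`, with `P 0 = ⊥` so that the first layer `W 0` is all of `V
  -- 0`. The layers `W n` are the orthogonal differences of the filtration.
  let P : ℕ → Submodule ℂ E := fun n => match n with | 0 => ⊥ | n + 1 => V n
  have hP : ∀ n, P n ≤ V n := fun n => by
    cases n with
    | zero => exact bot_le
    | succ n => exact hV n.le_succ
  have hAP : ∀ n, ∀ x ∈ P n, ∃ y ∈ P n, (x, y) ∈ A.graph := fun n => by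
    cases n with
    | zero => intro x hx; exact ⟨0, zero_mem _, by rw [(Submodule.mem_bot ℂ).mp hx]; exact zero_mem _⟩
    | succ n => exact hAV n
  have hPfin : ∀ n, FiniteDimensional ℂ ↥(P n) := fun n => by
    cases n with
    | zero => exact inferInstanceAs (FiniteDimensional ℂ ↥(⊥ : Submodule ℂ E))
    | succ n => exact inferInstanceAs (FiniteDimensional ℂ ↥(V n))
  let W : ℕ → Submodule ℂ E := fun n => V n ⊓ (P n)ᗮ
  have hWV : ∀ n, W n ≤ V n := fun n => inf_le_left
  have hWfin : ∀ n, FiniteDimensional ℂ ↥(W n) := fun n => Submodule.finiteDimensional_inf_left _ _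
  have hAW : ∀ n, ∀ x ∈ W n, ∃ y ∈ W n, (x, y) ∈ A.graph := fun n x hx => by
    obtain ⟨y, hy, hxy⟩ := hAV n x hx.1
    refine ⟨y, ⟨hy, (Submodule.mem_orthogonal _ _).mpr fun u hu => ?_⟩, hxy⟩
    obtain ⟨w, hw, huw⟩ := hAP n u hu
    -- Symmetry moves $A$ onto $u \in P_n$, whose image stays in $P_n$; so $A$ preserves the
    -- orthogonal difference as well.
    rw [← hA huw hxy]
    exact (Submodule.mem_orthogonal _ _).mp hx.2 w hw
  choose d v l hvl using fun n => exists_orthonormal_eigenbasis hA (W n) (hAW n)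
  have horth : OrthogonalFamily ℂ (fun n => W n) fun n => (W n).subtypeₗᵢ := by
    have hlt : ∀ i j, i < j → ∀ (x : W i) (y : W j), ⟪(x : E), (y : E)⟫_ℂ = 0 := by
      intro i j hij x y
      refine (Submodule.mem_orthogonal _ _).mp y.2.2 x ?_
      cases j with
      | zero => exact absurd hij (Nat.not_lt_zero _)
      | succ j => exact hV (Nat.lt_succ_iff.mp hij) x.2.1
    intro i j hij x y
    rcases lt_or_gt_of_ne hij with h | h
    · exact hlt i j h x y
    · exact inner_eq_zero_symm.mp (hlt j i h y x)
  have hon := horth.orthonormal_sigma_orthonormal (v_family := fun n => v n) fun n => (v n).orthonormal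
  -- Splitting off the projection to `P n` gives $V_n \subseteq P_n + W_n$; as `P (n + 1)` is `V n`,
  -- induction recovers every `V n` from the layers.
  have hVW : ∀ n, V n ≤ ⨆ n, W n := by
    have hstep : ∀ n, V n ≤ P n ⊔ W n := fun n x hx => by
      have h2 : (P n).starProjection x ∈ P n := Submodule.starProjection_apply_mem _ _
      rw [← add_sub_cancel ((P n).starProjection x) x]
      exact Submodule.add_mem_sup h2 ⟨sub_mem hx (hP n h2), Submodule.sub_starProjection_mem_orthogonal x⟩
    intro n
    induction n with
    | zero => exact (hstep 0).trans (sup_le bot_le (le_iSup W 0))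
    | succ n ih => exact (hstep (n + 1)).trans (sup_le ih (le_iSup W (n + 1)))
  have hspan : ∀ n, W n ≤ Submodule.span ℂ (Set.range fun a : Σ n, Fin (d n) =>
      (W a.1).subtypeₗᵢ (v a.1 a.2)) := by
    intro n x hx
    have h := (v n).sum_repr ⟨x, hx⟩
    have h2 := congrArg Subtype.val h
    rw [← (show _ = x from h2), Submodule.coe_sum]
    exact Submodule.sum_mem _ fun k _ => Submodule.smul_mem _ _ (Submodule.subset_span ⟨⟨n, k⟩, rfl⟩)
  refine ⟨Σ n, Fin (d n), HilbertBasis.mk hon ?_, fun a => l a.1 a.2, ?_, ?_⟩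
  · rw [← hd]
    exact Submodule.topologicalClosure_mono
      ((iSup_le hVW).trans (iSup_le hspan))
  · intro a
    rw [HilbertBasis.coe_mk]
    exact hvl a.1 a.2
  · intro a
    rw [HilbertBasis.coe_mk]
    exact ⟨a.1, (v a.1 a.2).2.1⟩

end EigenBasis

/-! ### Continuity and functoriality of second quantization -/

section FockContinuity

variable {E : Type*} [NormedAddCommGroup E] [InnerProductSpace ℂ E]
variable {E' : Type*} [NormedAddCommGroup E'] [InnerProductSpace ℂ E']

/-- Expand $\|w(x)-w(x_0)\|^2$. This suits wedge products, whose inner products are explicit Gram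
determinants. -/
theorem continuous_of_continuous_inner {X : Type*} [TopologicalSpace X] {w : X → E}
    (h1 : Continuous fun x => ⟪w x, w x⟫_ℂ) (h2 : ∀ x₀, Continuous fun x => ⟪w x₀, w x⟫_ℂ) :
    Continuous w := by
  rw [continuous_iff_continuousAt]
  intro x₀
  have h3 : Continuous fun x => (⟪w x, w x⟫_ℂ).re - 2 * (⟪w x₀, w x⟫_ℂ).re + (⟪w x₀, w x₀⟫_ℂ).re := by
    have := h2 x₀
    fun_prop
  have h4 : ∀ x, ‖w x - w x₀‖ = Real.sqrt
      ((⟪w x, w x⟫_ℂ).re - 2 * (⟪w x₀, w x⟫_ℂ).re + (⟪w x₀, w x₀⟫_ℂ).re) := by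
    intro x
    rw [@norm_eq_sqrt_re_inner ℂ]
    congr 1
    rw [inner_sub_left, inner_sub_right, inner_sub_right]
    have h5 := re_inner_symm (w x) (w x₀)
    simp only [map_sub, RCLike.re_to_complex]
    linarith
  rw [ContinuousAt, tendsto_iff_norm_sub_tendsto_zero]
  simp only [h4]
  have h6 := (Real.continuous_sqrt.comp h3).tendsto x₀
  rw [Function.comp_apply, show (⟪w x₀, w x₀⟫_ℂ).re - 2 * (⟪w x₀, w x₀⟫_ℂ).re + (⟪w x₀, w x₀⟫_ℂ).re = 0
    by ring, Real.sqrt_zero] at h6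
  exact h6

theorem continuous_wedge {X : Type*} [TopologicalSpace X] {n : ℕ} {u : X → Fin n → E}
    (hu : ∀ i, Continuous fun x => u x i) :
    Continuous fun x => (ExteriorAlgebra.ιMulti ℂ n (u x) : ExteriorAlgebra ℂ E) := by
  refine continuous_of_continuous_inner ?_ fun x₀ => ?_
  · simp only [inner_wedge]
    exact Continuous.matrix_det (continuous_matrix fun i j => (hu i).inner (hu j))
  · simp only [inner_wedge]
    exact Continuous.matrix_det (continuous_matrix fun i j => continuous_const.inner (hu j))

/-- The second quantization of a strongly continuous family of unitary operators is strongly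
continuous. -/
theorem continuous_fockMap {X : Type*} [TopologicalSpace X] {U : X → (E ≃ₗᵢ[ℂ] E)}
    (hU : ∀ x, Continuous fun t => U t x) (Φ : Fock E) : Continuous fun t => fockMap (U t) Φ := by
  have h1 : ∀ y : ExteriorAlgebra ℂ E,
      (y : Fock E) ∈ continuousVectors fun t => fockMap (U t) := by
    intro y
    induction y using wedge_induction with
    | h0 => rw [UniformSpace.Completion.coe_zero]; exact zero_mem _
    | hadd a b ha hb => rw [UniformSpace.Completion.coe_add]; exact add_mem ha hb
    | hsmul c a ha => rw [UniformSpace.Completion.coe_smul]; exact Submodule.smul_mem _ _ ha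
    | hw n u =>
      change Continuous fun t => fockMap (U t) _
      simp only [fockMap_wedge]
      exact (UniformSpace.Completion.continuous_coe _).comp
        (continuous_wedge fun i => hU (u i))
  induction Φ using UniformSpace.Completion.induction_on with
  | hp => exact isClosed_continuousVectors fun t => fockMap (U t)
  | ih y => exact h1 y

theorem fockMap_trans {E'' : Type*} [NormedAddCommGroup E''] [InnerProductSpace ℂ E'']
    (U : E ≃ₗᵢ[ℂ] E') (V : E' ≃ₗᵢ[ℂ] E'') : fockMap (U.trans V) = (fockMap U).trans (fockMap V) :=
  LinearIsometryEquiv.ext (fockHom_trans U V)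

theorem fockMap_symm (U : E ≃ₗᵢ[ℂ] E') : fockMap U.symm = (fockMap U).symm :=
  LinearIsometryEquiv.ext fun _ => rfl

/-- $\Lambda$ respects composition and inverses, so $\Lambda(F)$ conjugates the second quantized
groups and hence their generators. No description of the domain of $d\Lambda$ is needed. -/
theorem mem_graph_dFock {A : E →ₗ.[ℂ] E} {B : E' →ₗ.[ℂ] E'} (F : E ≃ₗᵢ[ℂ] E')
    (h : ∀ t, unitaryGroup B t = (F.symm.trans (unitaryGroup A t)).trans F) {Φ Ψ : Fock E} :
    (fockMap F Φ, fockMap F Ψ) ∈ (dFock B).graph ↔ (Φ, Ψ) ∈ (dFock A).graph := by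
  simp only [dFock, h, fockMap_trans, fockMap_symm]
  exact mem_graph_stoneGenerator_conj _ _

end FockContinuity

/-! ### Algebra of polynomial spinors: su(2) relations, Casimir identity, invariance -/

noncomputable section Polynomials

/-- Polynomials in the entries of a `2 × 2` matrix. -/
abbrev MatPoly : Type := MvPolynomial (Fin 2 × Fin 2) ℂ

/-- The derivation with `x ↦ x A` on the matrix `x` of variables. -/
def rightDer (A : Matrix (Fin 2) (Fin 2) ℂ) : Derivation ℂ MatPoly MatPoly :=
  MvPolynomial.mkDerivation ℂ fun i => ∑ c, A c i.2 • MvPolynomial.X (i.1, c)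

theorem rightDer_X (A : Matrix (Fin 2) (Fin 2) ℂ) (i : Fin 2 × Fin 2) :
    rightDer A (MvPolynomial.X i) = ∑ c, A c i.2 • MvPolynomial.X (i.1, c) :=
  MvPolynomial.mkDerivation_X _ _ _

theorem rightDer_add (A B : Matrix (Fin 2) (Fin 2) ℂ) (p : MatPoly) :
    rightDer (A + B) p = rightDer A p + rightDer B p := by
  have h : rightDer (A + B) = rightDer A + rightDer B := by
    refine MvPolynomial.derivation_ext fun i => ?_
    simp only [Derivation.add_apply, rightDer_X, Matrix.add_apply, add_smul, Finset.sum_add_distrib]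
  rw [h, Derivation.add_apply]

theorem rightDer_smul (c : ℂ) (A : Matrix (Fin 2) (Fin 2) ℂ) (p : MatPoly) :
    rightDer (c • A) p = c • rightDer A p := by
  have h : rightDer (c • A) = c • rightDer A := by
    refine MvPolynomial.derivation_ext fun i => ?_
    simp only [Derivation.smul_apply, rightDer_X, Matrix.smul_apply, smul_assoc, Finset.smul_sum]
  rw [h, Derivation.smul_apply]

/-- `A ↦ rightDer A p` as a linear map. -/
def rightDerLin (p : MatPoly) : Matrix (Fin 2) (Fin 2) ℂ →ₗ[ℂ] MatPoly where
  toFun A := rightDer A p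
  map_add' A B := rightDer_add A B p
  map_smul' c A := rightDer_smul c A p

/-- Both sides are derivations, so it is enough to compare them on the variables. -/
theorem rightDer_comm (A B : Matrix (Fin 2) (Fin 2) ℂ) (p : MatPoly) :
    rightDer A (rightDer B p) - rightDer B (rightDer A p) = rightDer (A * B - B * A) p := by
  have h : ⁅rightDer A, rightDer B⁆ = rightDer (A * B - B * A) := by
    refine MvPolynomial.derivation_ext fun i => ?_
    simp only [Derivation.commutator_apply, rightDer_X, Fin.sum_univ_two, map_add,
      Derivation.map_smul, Matrix.sub_apply, Matrix.mul_apply]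
    module
  rw [← h, Derivation.commutator_apply]

/-- The substitution `x ↦ g x h` for the matrix `x` of variables. -/
def substPoly (g h : Matrix (Fin 2) (Fin 2) ℂ) : MatPoly →ₐ[ℂ] MatPoly :=
  MvPolynomial.aeval fun i => ∑ c, ∑ d, (g i.1 c * h d i.2) • MvPolynomial.X (c, d)

theorem substPoly_X (g h : Matrix (Fin 2) (Fin 2) ℂ) (i : Fin 2 × Fin 2) :
    substPoly g h (MvPolynomial.X i) = ∑ c, ∑ d, (g i.1 c * h d i.2) • MvPolynomial.X (c, d) :=
  MvPolynomial.aeval_X _ _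

/-- The chain rule: along the field $x \mapsto xA$ the matrix $gxh$ varies by $gxAh = (gxh)B$. -/
theorem rightDer_substPoly {g h A B : Matrix (Fin 2) (Fin 2) ℂ} (hAB : A * h = h * B) (p : MatPoly) :
    rightDer A (substPoly g h p) = substPoly g h (rightDer B p) := by
  induction p using MvPolynomial.induction_on with
  | C a => simp [MvPolynomial.algebraMap_eq, substPoly, rightDer]
  | add p q hp hq => simp only [map_add, hp, hq]
  | mul_X p i hp =>
    have hX : rightDer A (substPoly g h (MvPolynomial.X i)) =
        substPoly g h (rightDer B (MvPolynomial.X i)) := by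
      have hij : ∀ a b, (A * h) a b = (h * B) a b := fun a b => by rw [hAB]
      simp only [Matrix.mul_apply, Fin.sum_univ_two] at hij
      simp only [substPoly_X, rightDer_X, Fin.sum_univ_two, map_add, map_smul, Derivation.map_smul]
      have h0 := hij 0 i.2
      have h1 := hij 1 i.2
      linear_combination (norm := module) (h0 * g i.1 0) • (MvPolynomial.X (0, 0) : MatPoly) +
        (h0 * g i.1 1) • (MvPolynomial.X (1, 0) : MatPoly) +
        (h1 * g i.1 0) • (MvPolynomial.X (0, 1) : MatPoly) +
        (h1 * g i.1 1) • (MvPolynomial.X (1, 1) : MatPoly)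
    simp only [map_mul, Derivation.leibniz, map_add, smul_eq_mul, hp, hX]

/-- Spinors with polynomial components. -/
abbrev SpinPoly : Type := Fin 2 → MatPoly

/-- The generator of right translations by `exp(i t σⱼ / 2)`, on polynomials. -/
def polyGen (j : Fin 3) : Derivation ℂ MatPoly MatPoly := rightDer ((1 / 2 : ℂ) • pauli j)

/-- The operator `4 ∑ⱼ Bⱼ Sⱼ` on polynomial spinors. -/
def polySpinOrbit (f : SpinPoly) : SpinPoly := fun a =>
  (4 : ℂ) • ∑ j, ∑ b, ((1 / 2 : ℂ) • pauli j) a b • polyGen j (f b)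

theorem polyGen_comm_zero_one (p : MatPoly) :
    polyGen 0 (polyGen 1 p) - polyGen 1 (polyGen 0 p) = Complex.I • polyGen 2 p := by
  rw [polyGen, polyGen, rightDer_comm, polyGen, ← rightDer_smul]
  congr 2
  ext a b
  fin_cases a <;> fin_cases b <;> simp [pauli] <;> ring

theorem polyGen_comm_one_two (p : MatPoly) :
    polyGen 1 (polyGen 2 p) - polyGen 2 (polyGen 1 p) = Complex.I • polyGen 0 p := by
  rw [polyGen, polyGen, rightDer_comm, polyGen, ← rightDer_smul]
  congr 2
  ext a b
  fin_cases a <;> fin_cases b <;> simp [pauli] <;> ring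

theorem polyGen_comm_two_zero (p : MatPoly) :
    polyGen 2 (polyGen 0 p) - polyGen 0 (polyGen 2 p) = Complex.I • polyGen 1 p := by
  rw [polyGen, polyGen, rightDer_comm, polyGen, ← rightDer_smul]
  congr 2
  ext a b
  fin_cases a <;> fin_cases b <;> simp [pauli] <;> grind [Complex.I_sq]

theorem polySpinOrbit_zero (f : SpinPoly) : polySpinOrbit f 0 =
    (2 : ℂ) • (polyGen 2 (f 0) + polyGen 0 (f 1) - Complex.I • polyGen 1 (f 1)) := by
  simp [polySpinOrbit, Fin.sum_univ_three, pauli, Fin.sum_univ_two]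
  module

theorem polySpinOrbit_one (f : SpinPoly) : polySpinOrbit f 1 =
    (2 : ℂ) • (polyGen 0 (f 0) + Complex.I • polyGen 1 (f 0) - polyGen 2 (f 1)) := by
  simp [polySpinOrbit, Fin.sum_univ_three, pauli, Fin.sum_univ_two]
  module

/-- The Casimir operator in terms of the spin-orbit coupling. -/
theorem four_casimir (f : SpinPoly) (a : Fin 2) :
    (4 : ℂ) • ∑ j, polyGen j (polyGen j (f a)) =
      polySpinOrbit (polySpinOrbit f) a + (2 : ℂ) • polySpinOrbit f a := by
  have hI : Complex.I * Complex.I = -1 := Complex.I_mul_I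
  fin_cases a
  · simp only [Fin.zero_eta, polySpinOrbit_zero, polySpinOrbit_one, Fin.sum_univ_three,
      map_add, map_sub, Derivation.map_smul]
    have h1 := polyGen_comm_zero_one (f 0)
    have h2 := polyGen_comm_one_two (f 1)
    have h3 := polyGen_comm_two_zero (f 1)
    -- Squaring $T$ produces $4\sum B_j^2$ and cross terms that group into commutators. The
    -- coefficients are those of the three commutators in $T^2$, with the opposite sign; the su(2)
    -- relations turn them into $2T$.
    linear_combination (norm := skip) (-4 * Complex.I) • h1 + (-4 * Complex.I) • h2 + (-4 : ℂ) • h3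
    match_scalars <;> grind
  · simp only [Fin.mk_one, polySpinOrbit_zero, polySpinOrbit_one, Fin.sum_univ_three,
      map_add, map_sub, Derivation.map_smul]
    have h1 := polyGen_comm_zero_one (f 1)
    have h2 := polyGen_comm_one_two (f 0)
    have h3 := polyGen_comm_two_zero (f 0)
    linear_combination (norm := skip) (4 * Complex.I) • h1 + (-4 * Complex.I) • h2 + (4 : ℂ) • h3
    match_scalars <;> grind

/-- The action `(f ↦ h f(g x h))` on polynomial spinors. -/
def substSpin (g h : Matrix (Fin 2) (Fin 2) ℂ) (f : SpinPoly) : SpinPoly := fun a =>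
  ∑ b, h a b • substPoly g h (f b)

/-- The matrices `4 ∑ⱼ (σⱼ / 2)ₐᵦ σⱼ / 2`. -/
def pauliSwap (a b : Fin 2) : Matrix (Fin 2) (Fin 2) ℂ :=
  ∑ j, (4 * ((1 / 2 : ℂ) • pauli j) a b) • ((1 / 2 : ℂ) • pauli j)

/-- As an operator on $\mathbb C^2\otimes\mathbb C^2$, $\sum_j\sigma_j\otimes\sigma_j$ is twice the
flip minus the identity. This makes the invariance of the spin-orbit term independent of particular
Pauli matrices. -/
theorem pauliSwap_apply (a b p q : Fin 2) : pauliSwap a b p q =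
    2 * (if p = b ∧ q = a then 1 else 0) - if a = b ∧ p = q then 1 else 0 := by
  fin_cases a <;> fin_cases b <;> fin_cases p <;> fin_cases q <;>
    simp [pauliSwap, Fin.sum_univ_three, pauli] <;> grind [Complex.I_sq]

theorem rightDer_pauliSwap (a b : Fin 2) (p : MatPoly) : rightDer (pauliSwap a b) p =
    ∑ j, (4 * ((1 / 2 : ℂ) • pauli j) a b) • polyGen j p := by
  change rightDerLin p (∑ j, _) = _
  rw [map_sum]
  exact Finset.sum_congr rfl fun j _ => LinearMap.map_smul _ _ _

theorem polySpinOrbit_apply (f : SpinPoly) (a : Fin 2) :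
    polySpinOrbit f a = ∑ b, rightDer (pauliSwap a b) (f b) := by
  simp only [rightDer_pauliSwap, polySpinOrbit, Finset.smul_sum, smul_smul]
  rw [Finset.sum_comm]

/-- In coordinates: the flip commutes with $h\otimes h$, for every matrix $h$. -/
theorem sum_smul_pauliSwap_mul (h : Matrix (Fin 2) (Fin 2) ℂ) (a c : Fin 2) :
    ∑ b, h b c • (pauliSwap a b * h) = h * ∑ d, h a d • pauliSwap d c := by
  ext p q
  simp only [Matrix.mul_apply, Fin.sum_univ_two, Matrix.add_apply, Matrix.smul_apply,
    pauliSwap_apply, smul_eq_mul]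
  fin_cases a <;> fin_cases c <;> fin_cases p <;> fin_cases q <;> simp <;>
    first | ring1 | (left; ring1)

theorem sum_smul_conj_pauliSwap {h k : Matrix (Fin 2) (Fin 2) ℂ} (hk : k * h = 1) (a c : Fin 2) :
    ∑ b, h b c • (k * pauliSwap a b * h) = ∑ d, h a d • pauliSwap d c := by
  have h1 := congrArg (k * ·) (sum_smul_pauliSwap_mul h a c)
  simp only [← mul_assoc, hk, one_mul] at h1
  rw [← h1, Finset.mul_sum]
  simp only [Matrix.mul_smul, mul_assoc]

/-- By the chain rule, moving the derivation past the substitution conjugates its matrix by $h$;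
commutation with the flip absorbs this into the action of $h$ on the spinor index. Only
invertibility of $h$ matters, and $g$ is arbitrary. -/
theorem substSpin_polySpinOrbit {g h k : Matrix (Fin 2) (Fin 2) ℂ} (hk : h * k = 1) (f : SpinPoly) :
    polySpinOrbit (substSpin g h f) = substSpin g h (polySpinOrbit f) := by
  have hA : ∀ A p, rightDer A (substPoly g h p) = substPoly g h (rightDer (k * A * h) p) :=
    fun A p => rightDer_substPoly (by rw [← mul_assoc, ← mul_assoc, hk, one_mul]) p
  funext a
  have hlin : ∀ (c : Fin 2 → ℂ) (M : Fin 2 → Matrix (Fin 2) (Fin 2) ℂ) (p : MatPoly),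
      ∑ b, c b • rightDer (M b) p = rightDer (∑ b, c b • M b) p := by
    intro c M p
    change _ = rightDerLin p (∑ b, c b • M b)
    rw [map_sum]
    exact Finset.sum_congr rfl fun j _ => (LinearMap.map_smul (rightDerLin p) _ _).symm
  calc polySpinOrbit (substSpin g h f) a
      = ∑ c, ∑ b, h b c • substPoly g h (rightDer (k * pauliSwap a b * h) (f c)) := by
        rw [polySpinOrbit_apply, Finset.sum_comm]
        simp only [substSpin, map_sum, Derivation.map_smul, hA]
    _ = ∑ c, substPoly g h (rightDer (∑ b, h b c • (k * pauliSwap a b * h)) (f c)) := by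
        simp only [← hlin, map_sum, map_smul]
    _ = ∑ c, substPoly g h (rightDer (∑ d, h a d • pauliSwap d c) (f c)) := by
        simp only [sum_smul_conj_pauliSwap (mul_eq_one_comm.mp hk)]
    _ = substSpin g h (polySpinOrbit f) a := by
        simp only [← hlin, map_sum, map_smul, substSpin, polySpinOrbit_apply, Finset.smul_sum]
        rw [Finset.sum_comm]

/-- The span of the constants and the linear polynomials. -/
def polyDegOne : Submodule ℂ MatPoly := Submodule.span ℂ ({1} ∪ Set.range MvPolynomial.X)

theorem one_mem_polyDegOne : (1 : MatPoly) ∈ polyDegOne := Submodule.subset_span (Or.inl rfl)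

theorem X_mem_polyDegOne (i) : (MvPolynomial.X i : MatPoly) ∈ polyDegOne :=
  Submodule.subset_span (Or.inr ⟨i, rfl⟩)

theorem monotone_polyDegOne_pow : Monotone fun n => polyDegOne ^ n :=
  monotone_nat_of_le_succ fun n => by
    rw [pow_succ]
    intro p hp
    rw [← mul_one p]
    exact Submodule.mul_mem_mul hp one_mem_polyDegOne

theorem fg_polyDegOne_pow (n : ℕ) : (polyDegOne ^ n).FG :=
  Submodule.FG.pow (Submodule.fg_span ((Set.finite_singleton _).union (Set.finite_range _))) n

/-- The field $x\mapsto xA$ is linear, so it preserves degree at most one, and the Leibniz rule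
extends this to powers. -/
theorem rightDer_mem_polyDegOne_pow (A : Matrix (Fin 2) (Fin 2) ℂ) (n : ℕ) {p : MatPoly}
    (hp : p ∈ polyDegOne ^ n) : rightDer A p ∈ polyDegOne ^ n := by
  have h1 : ∀ p ∈ polyDegOne, rightDer A p ∈ polyDegOne := by
    intro p hp
    induction hp using Submodule.span_induction with
    | mem x hx =>
      rcases hx with rfl | ⟨i, rfl⟩
      · simp
      · rw [rightDer_X]
        exact Submodule.sum_mem _ fun c _ => Submodule.smul_mem _ _ (X_mem_polyDegOne _)
    | zero => simp
    | add x y _ _ hx hy => rw [map_add]; exact add_mem hx hy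
    | smul c x _ hx => rw [Derivation.map_smul]; exact Submodule.smul_mem _ _ hx
  induction n generalizing p with
  | zero =>
    rw [pow_zero, Submodule.mem_one] at hp
    obtain ⟨c, rfl⟩ := hp
    rw [Derivation.map_algebraMap]
    exact zero_mem _
  | succ n ih =>
    rw [pow_succ] at hp
    refine Submodule.mul_induction_on hp (fun a ha b hb => ?_) fun x y hx hy => ?_
    · rw [Derivation.leibniz, pow_succ, smul_eq_mul, smul_eq_mul, mul_comm b]
      exact add_mem (Submodule.mul_mem_mul ha (h1 b hb)) (Submodule.mul_mem_mul (ih ha) hb)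
    · rw [map_add]; exact add_mem hx hy

theorem exists_mem_polyDegOne_pow (p : MatPoly) : ∃ n, p ∈ polyDegOne ^ n := by
  induction p using MvPolynomial.induction_on with
  | C a => exact ⟨0, by rw [pow_zero]; exact Submodule.mem_one.mpr ⟨a, rfl⟩⟩
  | add p q hp hq =>
    obtain ⟨m, hm⟩ := hp
    obtain ⟨n, hn⟩ := hq
    exact ⟨max m n, add_mem (monotone_polyDegOne_pow (le_max_left m n) hm)
      (monotone_polyDegOne_pow (le_max_right m n) hn)⟩
  | mul_X p i hp =>
    obtain ⟨n, hn⟩ := hp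
    exact ⟨n + 1, by rw [pow_succ]; exact Submodule.mul_mem_mul hn (X_mem_polyDegOne i)⟩

/-- The polynomial spinors of degree at most `n`. -/
def spinDeg (n : ℕ) : Submodule ℂ SpinPoly := Submodule.pi Set.univ fun _ => polyDegOne ^ n

theorem mem_spinDeg {n : ℕ} {f : SpinPoly} : f ∈ spinDeg n ↔ ∀ a, f a ∈ polyDegOne ^ n := by
  simp [spinDeg, Submodule.mem_pi]

theorem monotone_spinDeg : Monotone spinDeg := fun _ _ h _ hf =>
  mem_spinDeg.mpr fun a => monotone_polyDegOne_pow h (mem_spinDeg.mp hf a)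

theorem fg_spinDeg (n : ℕ) : (spinDeg n).FG :=
  Submodule.fg_pi fun _ => fg_polyDegOne_pow n

theorem polySpinOrbit_mem_spinDeg {n : ℕ} {f : SpinPoly} (hf : f ∈ spinDeg n) :
    polySpinOrbit f ∈ spinDeg n :=
  mem_spinDeg.mpr fun _ => Submodule.smul_mem _ _ <| Submodule.sum_mem _ fun _ _ =>
    Submodule.sum_mem _ fun b _ => Submodule.smul_mem _ _
      (rightDer_mem_polyDegOne_pow _ n (mem_spinDeg.mp hf b))

theorem exists_mem_spinDeg (f : SpinPoly) : ∃ n, f ∈ spinDeg n := by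
  choose n hn using fun a => exists_mem_polyDegOne_pow (f a)
  refine ⟨max (n 0) (n 1), mem_spinDeg.mpr fun a => ?_⟩
  fin_cases a
  · exact monotone_polyDegOne_pow (le_max_left _ _) (hn 0)
  · exact monotone_polyDegOne_pow (le_max_right _ _) (hn 1)

end Polynomials

/-! ### Polynomial spinors in $L^2(S^3)\otimes\mathbb C^2$: density and derivatives -/

noncomputable section Embedding

/-- The matrix entries as continuous functions on SU(2). -/
def entry (i : Fin 2 × Fin 2) : C(SU2, ℂ) where
  toFun x := (x : Matrix (Fin 2) (Fin 2) ℂ) i.1 i.2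
  continuous_toFun := (continuous_apply_apply i.1 i.2).comp continuous_subtype_val

/-- Evaluation of polynomials on SU(2). -/
def polyEval : MatPoly →ₐ[ℂ] C(SU2, ℂ) := MvPolynomial.aeval entry

theorem polyEval_X (i) : polyEval (MvPolynomial.X i) = entry i := MvPolynomial.aeval_X _ _

theorem entry_apply (i) (x : SU2) : entry i x = (x : Matrix (Fin 2) (Fin 2) ℂ) i.1 i.2 := rfl

/-- Translation of continuous functions, `u ↦ u(g₁⁻¹ x g₂)`. -/
def contTranslate (g : SU2 × SU2) : C(SU2, ℂ) →ₐ[ℂ] C(SU2, ℂ) :=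
  ContinuousMap.compRightAlgHom ℂ ℂ ⟨fun x : SU2 => g.1⁻¹ * x * g.2, by fun_prop⟩

theorem contTranslate_apply (g : SU2 × SU2) (u : C(SU2, ℂ)) (x : SU2) :
    contTranslate g u x = u (g.1⁻¹ * x * g.2) := rfl

theorem contTranslate_polyEval (g : SU2 × SU2) (p : MatPoly) :
    contTranslate g (polyEval p) = polyEval (substPoly (g.1⁻¹ : SU2) g.2 p) := by
  have h : (contTranslate g).comp polyEval = polyEval.comp (substPoly (g.1⁻¹ : SU2) g.2) := by
    refine MvPolynomial.algHom_ext fun i => ?_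
    ext x
    simp only [AlgHom.comp_apply, polyEval_X, contTranslate_apply, substPoly_X, Fin.sum_univ_two,
      map_add, map_smul, ContinuousMap.add_apply, ContinuousMap.smul_apply, entry_apply,
      Submonoid.coe_mul, Matrix.mul_apply, smul_eq_mul]
    ring
  exact DFunLike.congr_fun h p

/-- The function `x ↦ u(x) eₐ` as an element of `L²`. -/
def component (a : Fin 2) : C(SU2, ℂ) →L[ℂ] HydrogenSpace :=
  (ContinuousMap.toLp 2 sphereMeasure ℂ).comp
    ((ContinuousLinearMap.toSpanSingleton ℂ (EuclideanSpace.single a (1 : ℂ) : Spin)).compLeftContinuous ℂ SU2)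

theorem component_ae (a : Fin 2) (u : C(SU2, ℂ)) :
    component a u =ᵐ[sphereMeasure] fun x => u x • (EuclideanSpace.single a (1 : ℂ) : Spin) :=
  ContinuousMap.coeFn_toLp _ _

theorem translate_component (g : SU2 × SU2) (a : Fin 2) (u : C(SU2, ℂ)) :
    translate g (component a u) = component a (contTranslate g u) := by
  apply Lp.ext
  filter_upwards [translate_ae g (component a u), component_ae a (contTranslate g u),
    (measurePreserving_translate g).quasiMeasurePreserving.ae_eq_comp (component_ae a u)] with x h1 h2 h3
  rw [h1, h2]
  exact h3

theorem spinOp_component (M : Matrix (Fin 2) (Fin 2) ℂ) (a : Fin 2) (u : C(SU2, ℂ)) :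
    spinOp M (component a u) = ∑ b, M b a • component b u := by
  apply Lp.ext
  rw [Fin.sum_univ_two]
  filter_upwards [spinOp_ae M (component a u), component_ae a u, component_ae 0 u, component_ae 1 u,
    Lp.coeFn_add (M 0 a • component 0 u) (M 1 a • component 1 u),
    Lp.coeFn_smul (M 0 a) (component 0 u), Lp.coeFn_smul (M 1 a) (component 1 u)]
    with x h1 h2 h3 h4 h5 h6 h7
  rw [h1, h2, h5, Pi.add_apply, h6, h7, Pi.smul_apply, Pi.smul_apply, h3, h4]
  ext i
  fin_cases i <;> simp [mul_comm]

/-- Polynomial spinors as elements of `L²`. -/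
def spinEval : SpinPoly →ₗ[ℂ] HydrogenSpace :=
  ∑ a, (component a).toLinearMap ∘ₗ polyEval.toLinearMap ∘ₗ LinearMap.proj a

theorem spinEval_apply (f : SpinPoly) : spinEval f = ∑ a, component a (polyEval (f a)) := by
  simp [spinEval]

theorem translate_spinEval (g : SU2 × SU2) (f : SpinPoly) :
    translate g (spinEval f) = spinEval fun a => substPoly (g.1⁻¹ : SU2) g.2 (f a) := by
  simp only [spinEval_apply, map_sum, translate_component, contTranslate_polyEval]

theorem spinOp_spinEval (M : Matrix (Fin 2) (Fin 2) ℂ) (f : SpinPoly) :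
    spinOp M (spinEval f) = spinEval fun a => ∑ b, M a b • f b := by
  simp only [spinEval_apply, map_sum, spinOp_component, map_smul]
  rw [Finset.sum_comm]

theorem rho_spinEval (g : SU2 × SU2) (f : SpinPoly) :
    rho g (spinEval f) = spinEval (substSpin (g.1⁻¹ : SU2) g.2 f) := by
  change spinOp g.2 (translate g (spinEval f)) = _
  rw [translate_spinEval, spinOp_spinEval]
  rfl

instance : sphereMeasure.Regular := inferInstanceAs (Measure.haarMeasure ⊤).Regular

/-- On SU(2) the adjoint is the inverse, which for determinant one is the adjugate. So conjugates of
entries are again entries up to sign: this gives closure under conjugation for Stone–Weierstrass,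
and later $\epsilon\bar g = g\epsilon$. -/
theorem star_SU2_apply (x : SU2) (a b : Fin 2) : star ((x : Matrix (Fin 2) (Fin 2) ℂ) a b) =
    (x : Matrix (Fin 2) (Fin 2) ℂ).adjugate b a := by
  have h : star (x : Matrix (Fin 2) (Fin 2) ℂ) = (x : Matrix (Fin 2) (Fin 2) ℂ).adjugate := by
    have h1 := Matrix.mem_specialUnitaryGroup_iff.mp x.2
    have h2 := Matrix.mul_adjugate (x : Matrix (Fin 2) (Fin 2) ℂ)
    rw [h1.2, one_smul] at h2
    rw [← one_mul (Matrix.adjugate _), ← Matrix.mem_unitaryGroup_iff'.mp h1.1, mul_assoc, h2, mul_one]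
  rw [← h]
  rfl

theorem star_entry (i : Fin 2 × Fin 2) : ∃ (c : ℂ) (k : Fin 2 × Fin 2), star (entry i) = c • entry k := by
  have h2 := star_SU2_apply
  simp only [Matrix.adjugate_fin_two] at h2
  obtain ⟨a, b⟩ := i
  refine ⟨if a = b then 1 else -1, (1 - a, 1 - b), ?_⟩
  ext x
  change star ((x : Matrix (Fin 2) (Fin 2) ℂ) a b) = _ * (x : Matrix (Fin 2) (Fin 2) ℂ) (1 - a) (1 - b)
  rw [h2]
  fin_cases a <;> fin_cases b <;> simp

theorem star_mem_range_polyEval (p : MatPoly) : star (polyEval p) ∈ polyEval.range := by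
  induction p using MvPolynomial.induction_on with
  | C a =>
    refine ⟨MvPolynomial.C (star a), ?_⟩
    ext x
    simp [polyEval]
  | add p q hp hq => rw [map_add, star_add]; exact add_mem hp hq
  | mul_X p i hp =>
    obtain ⟨c, k, h⟩ := star_entry i
    rw [map_mul, star_mul', polyEval_X, h]
    exact mul_mem hp (Subalgebra.smul_mem _ ((AlgHom.mem_range _).mpr ⟨MvPolynomial.X k, polyEval_X k⟩) c)

/-- Stone–Weierstrass: the entries separate points, and the algebra they generate is closed under
conjugation. -/
theorem denseRange_polyEval : DenseRange polyEval := by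
  let A : StarSubalgebra ℂ C(SU2, ℂ) :=
    { polyEval.range with
      star_mem' := by
        rintro _ ⟨p, rfl⟩
        exact star_mem_range_polyEval p }
  have hsep : A.SeparatesPoints := by
    intro x y hxy
    by_contra! hcon
    refine hxy (Subtype.ext ?_)
    ext a b
    have h1 := hcon (entry (a, b)) ⟨entry (a, b), ⟨MvPolynomial.X (a, b), polyEval_X _⟩, rfl⟩
    exact h1
  have h := ContinuousMap.starSubalgebra_topologicalClosure_eq_top_of_separatesPoints A hsep
  intro u
  have : u ∈ A.topologicalClosure := by rw [h]; trivial
  exact this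

theorem denseRange_spinEval : DenseRange spinEval := by
  have h1 : ∀ w ∈ Set.range (ContinuousMap.toLp 2 sphereMeasure ℂ : C(SU2, Spin) → HydrogenSpace),
      w ∈ closure (Set.range spinEval) := by
    rintro _ ⟨v, rfl⟩
    have h2 : ContinuousMap.toLp 2 sphereMeasure ℂ v =
        ∑ a, component a ((EuclideanSpace.proj a : Spin →L[ℂ] ℂ).compLeftContinuous ℂ SU2 v) := by
      simp only [component, ContinuousLinearMap.comp_apply]
      rw [← map_sum]
      congr 1
      ext x i
      rw [ContinuousMap.sum_apply, Fin.sum_univ_two]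
      fin_cases i <;> simp <;> rfl
    rw [h2, ← LinearMap.coe_range, ← Submodule.topologicalClosure_coe]
    refine Submodule.sum_mem _ fun a _ => ?_
    have h3 : Set.MapsTo (component a) (Set.range polyEval) (LinearMap.range spinEval) := by
      rintro _ ⟨p, rfl⟩
      refine ⟨Pi.single a p, ?_⟩
      rw [spinEval_apply, Finset.sum_eq_single a]
      · simp
      · intro b _ hb; simp [hb]
      · simp
    exact h3.closure (component a).continuous (denseRange_polyEval _)
  intro w
  have h4 := ContinuousMap.toLp_denseRange Spin sphereMeasure (p := 2) ℂ (by simp) w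
  exact isClosed_closure.closure_subset_iff.mpr h1 h4

theorem substPoly_pauliExp_zero (j : Fin 3) (p : MatPoly) : substPoly 1 (pauliExp j 0) p = p := by
  have h : substPoly 1 (pauliExp j 0) = AlgHom.id ℂ MatPoly := by
    refine MvPolynomial.algHom_ext fun i => ?_
    have : pauliExp j 0 = 1 := by simp [pauliExp]
    rw [this, substPoly_X]
    simp [Matrix.one_apply, mul_ite, ite_smul]
  rw [h, AlgHom.id_apply]

/-- The derivative is taken in the sup norm, where the product rule of a Banach algebra allows
induction on the polynomial; bounded maps then carry it to $L^2$. -/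
theorem hasDerivAt_polyEval (j : Fin 3) (p : MatPoly) :
    HasDerivAt (fun t : ℝ => polyEval (substPoly 1 (pauliExp j t) p))
      (Complex.I • polyEval (polyGen j p)) 0 := by
  induction p using MvPolynomial.induction_on with
  | C a =>
    simp only [← MvPolynomial.algebraMap_eq, AlgHom.commutes, Derivation.map_algebraMap, map_zero,
      smul_zero]
    exact hasDerivAt_const _ _
  | add p q hp hq =>
    simp only [map_add, smul_add]
    exact hp.add hq
  | mul_X p i hp =>
    have hX : HasDerivAt (fun t : ℝ => polyEval (substPoly 1 (pauliExp j t) (MvPolynomial.X i)))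
        (Complex.I • polyEval (polyGen j (MvPolynomial.X i))) 0 := by
      have hent : ∀ d, HasDerivAt (fun t : ℝ => pauliExp j t d i.2)
          (Complex.I * ((1 / 2 : ℂ) • pauli j) d i.2) 0 := by
        intro d
        have hhalf : HasDerivAt (fun t : ℝ => t / 2) (1 / 2) 0 := (hasDerivAt_id (0 : ℝ)).div_const 2
        have h1 := (hhalf.cos).ofReal_comp.mul_const ((1 : Matrix (Fin 2) (Fin 2) ℂ) d i.2)
        have h2 := ((hhalf.sin).ofReal_comp.const_mul Complex.I).mul_const (pauli j d i.2)
        have h3 := h1.add h2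
        simp only [pauliExp, Matrix.add_apply, Matrix.smul_apply, smul_eq_mul]
        refine h3.congr_deriv ?_
        simp
        ring
      simp only [substPoly_X, polyGen, rightDer_X, map_sum, map_smul, Finset.smul_sum, smul_smul,
        Matrix.one_apply, ite_mul, one_mul, zero_mul, ite_smul, zero_smul, Finset.sum_ite_irrel,
        Finset.sum_const_zero, Finset.sum_ite_eq, Finset.mem_univ, if_true]
      exact HasDerivAt.fun_sum fun d _ => (hent d).smul_const _
    have := hp.mul hX
    simp only [substPoly_pauliExp_zero] at this
    simp only [map_mul, Derivation.leibniz, map_add, smul_eq_mul, smul_add]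
    refine this.congr_deriv ?_
    rw [smul_mul_assoc, mul_smul_comm, mul_comm (polyEval (polyGen j p)), add_comm]

/-- Links algebra and analysis: polynomial spinors lie in the domain of each $B_j$, which acts on
them as the derivation `polyGen j`. -/
theorem spinEval_mem_graph (j : Fin 3) (f : SpinPoly) :
    (spinEval f, spinEval fun a => polyGen j (f a)) ∈ (rightGen j).graph := by
  rw [rightGen, mem_graph_stoneGenerator]
  have h : ∀ t, rightTranslate ⟨pauliExp j t, pauliExp_mem j t⟩ (spinEval f) =
      ∑ a, component a (polyEval (substPoly 1 (pauliExp j t) (f a))) := by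
    intro t
    change translate (1, _) (spinEval f) = _
    rw [translate_spinEval, spinEval_apply]
    simp
  have h2 : Complex.I • spinEval (fun a => polyGen j (f a)) =
      ∑ a, component a (Complex.I • polyEval (polyGen j (f a))) := by
    simp only [spinEval_apply, Finset.smul_sum, map_smul]
  simp only [h, h2]
  exact HasDerivAt.fun_sum fun a _ => ((component a).restrictScalars ℝ).hasFDerivAt.comp_hasDerivAt
    0 (hasDerivAt_polyEval j (f a))

theorem continuous_polyEval_subst (p : MatPoly) :
    Continuous fun g : SU2 × SU2 => polyEval (substPoly (g.1⁻¹ : SU2) g.2 p) := by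
  induction p using MvPolynomial.induction_on with
  | C a =>
    simp only [MvPolynomial.algHom_C, AlgHom.commutes]
    exact continuous_const
  | add p q hp hq => simp only [map_add]; exact hp.add hq
  | mul_X p i hp =>
    simp only [map_mul]
    refine hp.mul ?_
    simp only [substPoly_X, map_sum, map_smul]
    refine continuous_finsetSum _ fun c _ => continuous_finsetSum _ fun d _ => ?_
    have h1 : Continuous fun g : SU2 × SU2 => entry (i.1, c) g.1⁻¹ :=
      (entry (i.1, c)).continuous.comp continuous_fst.inv
    have h2 : Continuous fun g : SU2 × SU2 => entry (d, i.2) g.2 :=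
      (entry (d, i.2)).continuous.comp continuous_snd
    exact (h1.fun_mul h2).fun_smul continuous_const

/-- The operators are isometric, so a dense set of vectors suffices; on polynomial spinors the
dependence on $g$ is through matrix entries. -/
theorem continuous_rho (ψ : HydrogenSpace) : Continuous fun g => rho g ψ := by
  refine continuous_of_dense (fun g => rho g) (s := Set.range spinEval) ?_ ?_ ψ
  · exact denseRange_spinEval.mono Submodule.subset_span
  · rintro _ ⟨f, rfl⟩
    have h : ∀ g, rho g (spinEval f) = ∑ a, ∑ b, (g.2 : Matrix (Fin 2) (Fin 2) ℂ) a b •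
        component a (polyEval (substPoly (g.1⁻¹ : SU2) g.2 (f b))) := by
      intro g
      rw [rho_spinEval, spinEval_apply]
      simp only [substSpin, map_sum, map_smul]
    simp only [h]
    refine continuous_finsetSum _ fun a _ => continuous_finsetSum _ fun b _ => ?_
    have h1 : Continuous fun g : SU2 × SU2 => entry (a, b) g.2 :=
      (entry (a, b)).continuous.comp continuous_snd
    exact h1.fun_smul ((component a).continuous.comp (continuous_polyEval_subst (f b)))

end Embedding

/-! ### The Dirac operator: symmetry, Casimir estimate and eigenbasis -/

noncomputable section DiracOperator

theorem pauliExp_add (j : Fin 3) (s t : ℝ) : pauliExp j (s + t) = pauliExp j s * pauliExp j t := by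
  have hc : (Real.cos ((s + t) / 2) : ℂ) =
      Real.cos (s / 2) * Real.cos (t / 2) - Real.sin (s / 2) * Real.sin (t / 2) := by
    rw [add_div, Real.cos_add]; push_cast; rfl
  have hs : (Real.sin ((s + t) / 2) : ℂ) =
      Real.sin (s / 2) * Real.cos (t / 2) + Real.cos (s / 2) * Real.sin (t / 2) := by
    rw [add_div, Real.sin_add]; push_cast; rfl
  have hp : pauli j * pauli j = 1 := by
    fin_cases j <;> ext a b <;> fin_cases a <;> fin_cases b <;>
      simp [pauli]
  unfold pauliExp
  rw [hc, hs]
  simp only [add_mul, mul_add, smul_mul_assoc, mul_smul_comm, mul_one, one_mul, hp]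
  match_scalars <;> grind [Complex.I_sq]

theorem rightTranslate_mul (g h : SU2) (ψ : HydrogenSpace) :
    rightTranslate (g * h) ψ = rightTranslate g (rightTranslate h ψ) := by
  have hd : ∀ ψ, translate (1, g * h) ψ = translate (1, g) (translate (1, h) ψ) := by
    intro ψ
    apply Lp.ext
    filter_upwards [translate_ae (1, g * h) ψ, translate_ae (1, g) (translate (1, h) ψ),
      (measurePreserving_translate (1, g)).quasiMeasurePreserving.ae_eq_comp (translate_ae (1, h) ψ)]
      with x h1 h2 h3
    rw [h1, h2]
    simp only [Function.comp_apply] at h3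
    rw [h3]
    simp [mul_assoc]
  exact hd ψ

theorem isOneParam_rightTranslate (j : Fin 3) :
    IsOneParam fun t => rightTranslate ⟨pauliExp j t, pauliExp_mem j t⟩ where
  zero := by
    ext1 ψ
    refine DenseRange.induction_on (p := fun ψ => rightTranslate ⟨pauliExp j 0, _⟩ ψ = ψ)
      denseRange_spinEval ψ (isClosed_eq (LinearIsometryEquiv.continuous _) continuous_id) fun f => ?_
    change translate (1, _) (spinEval f) = spinEval f
    rw [translate_spinEval]
    congr 1
    funext a
    simp [substPoly_pauliExp_zero]
  add s t := by
    ext1 ψ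
    change _ = rightTranslate _ (rightTranslate _ ψ)
    rw [← rightTranslate_mul]
    congr 1
    exact congrArg rightTranslate (Subtype.ext (pauliExp_add j s t))

theorem rightTranslate_spinOp (h : SU2) (M : Matrix (Fin 2) (Fin 2) ℂ) (ψ : HydrogenSpace) :
    rightTranslate h (spinOp M ψ) = spinOp M (rightTranslate h ψ) := by
  refine DenseRange.induction_on (p := fun ψ => rightTranslate h (spinOp M ψ) =
    spinOp M (rightTranslate h ψ)) denseRange_spinEval ψ (isClosed_eq (by fun_prop) (by fun_prop))
    fun f => ?_
  change translate (1, _) _ = spinOp M (translate (1, _) _)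
  rw [spinOp_spinEval, translate_spinEval, translate_spinEval, spinOp_spinEval]
  simp only [map_sum, map_smul]

theorem inner_spinOp {M : Matrix (Fin 2) (Fin 2) ℂ} (hM : M.IsHermitian) (ψ φ : HydrogenSpace) :
    ⟪spinOp M ψ, φ⟫_ℂ = ⟪ψ, spinOp M φ⟫_ℂ := by
  rw [L2.inner_def, L2.inner_def]
  refine integral_congr_ae ?_
  filter_upwards [spinOp_ae M ψ, spinOp_ae M φ] with x h1 h2
  rw [h1, h2]
  have h3 : (Matrix.toEuclideanCLM (𝕜 := ℂ) M).adjoint = Matrix.toEuclideanCLM (𝕜 := ℂ) M := by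
    rw [← ContinuousLinearMap.star_eq_adjoint, ← map_star, Matrix.star_eq_conjTranspose, hM.eq]
  conv_rhs => rw [← h3]
  rw [ContinuousLinearMap.adjoint_inner_right]

theorem isHermitian_half_pauli (j : Fin 3) : ((1 / 2 : ℂ) • pauli j).IsHermitian := by
  fin_cases j <;> ext a b <;> fin_cases a <;> fin_cases b <;> simp [pauli]

theorem spinOp_mem_graph (M : Matrix (Fin 2) (Fin 2) ℂ) {j : Fin 3} {ψ η : HydrogenSpace}
    (h : (ψ, η) ∈ (rightGen j).graph) : (spinOp M ψ, spinOp M η) ∈ (rightGen j).graph :=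
  mem_graph_stoneGenerator_of_commute ((spinOp M).restrictScalars ℝ)
    (fun _ _ => rightTranslate_spinOp _ M _) h (map_smul (spinOp M) _ _).symm

theorem mem_graph_dirac {ψ χ : HydrogenSpace} : (ψ, χ) ∈ dirac.graph ↔
    ∃ η : Fin 3 → HydrogenSpace, (∀ j, (ψ, η j) ∈ (rightGen j).graph) ∧
      χ = (4 : ℂ) • (∑ j, spinOp ((1 / 2 : ℂ) • pauli j) (η j)) + (3 / 2 : ℂ) • ψ := by
  rw [LinearPMap.mem_graph_iff]
  constructor
  · rintro ⟨⟨φ, hφ⟩, rfl, h⟩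
    exact ⟨fun j => rightGen j ⟨φ, (Submodule.mem_iInf _).mp hφ j⟩,
      fun j => LinearPMap.mem_graph _ ⟨φ, (Submodule.mem_iInf _).mp hφ j⟩, h.symm⟩
  · rintro ⟨η, hη, rfl⟩
    have hd : ψ ∈ dirac.domain := (Submodule.mem_iInf _).mpr fun j =>
      LinearPMap.mem_domain_iff.mpr ⟨_, hη j⟩
    refine ⟨⟨ψ, hd⟩, rfl, ?_⟩
    have : η = fun j => rightGen j ⟨ψ, (Submodule.mem_iInf _).mp hd j⟩ := by
      funext j
      exact graph_snd_unique (hη j)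
        (LinearPMap.mem_graph _ ⟨ψ, (Submodule.mem_iInf _).mp hd j⟩)
    rw [this]
    rfl

theorem rightGen_symmetric {j : Fin 3} {x y x' y' : HydrogenSpace} (h : (x, y) ∈ (rightGen j).graph)
    (h' : (x', y') ∈ (rightGen j).graph) : ⟪y, x'⟫_ℂ = ⟪x, y'⟫_ℂ :=
  (isOneParam_rightTranslate j).symmetric h h'

/-- Each $S_j$ is Hermitian and commutes with right translations, so it preserves the domain of
$B_j$ and commutes with $B_j$ there. -/
theorem dirac_symmetric {x y x' y' : HydrogenSpace} (h : (x, y) ∈ dirac.graph)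
    (h' : (x', y') ∈ dirac.graph) : ⟪y, x'⟫_ℂ = ⟪x, y'⟫_ℂ := by
  obtain ⟨η, hη, rfl⟩ := mem_graph_dirac.mp h
  obtain ⟨η', hη', rfl⟩ := mem_graph_dirac.mp h'
  simp only [inner_add_left, inner_add_right, inner_smul_left, inner_smul_right, sum_inner, inner_sum]
  have h1 : ∀ j, ⟪spinOp ((1 / 2 : ℂ) • pauli j) (η j), x'⟫_ℂ =
      ⟪x, spinOp ((1 / 2 : ℂ) • pauli j) (η' j)⟫_ℂ := fun j => by
    rw [inner_spinOp (isHermitian_half_pauli j),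
      rightGen_symmetric (hη j) (spinOp_mem_graph _ (hη' j))]
  simp only [h1, map_div₀, map_ofNat]

/-- The Dirac operator on polynomial spinors. -/
def polyDirac (f : SpinPoly) : SpinPoly := polySpinOrbit f + (3 / 2 : ℂ) • f

theorem spinEval_polyDirac (f : SpinPoly) : spinEval (polyDirac f) =
    (4 : ℂ) • (∑ j, spinOp ((1 / 2 : ℂ) • pauli j) (spinEval fun a => polyGen j (f a))) +
      (3 / 2 : ℂ) • spinEval f := by
  have h : polySpinOrbit f =
      (4 : ℂ) • ∑ j, (fun a => ∑ b, ((1 / 2 : ℂ) • pauli j) a b • polyGen j (f b) : SpinPoly) := by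
    funext a
    rw [Pi.smul_apply, Finset.sum_apply]
    rfl
  simp only [spinOp_spinEval]
  rw [polyDirac, map_add, map_smul, h, map_smul, map_sum]

theorem spinEval_mem_graph_dirac (f : SpinPoly) :
    (spinEval f, spinEval (polyDirac f)) ∈ dirac.graph :=
  mem_graph_dirac.mpr ⟨_, fun j => spinEval_mem_graph j f, spinEval_polyDirac f⟩

theorem inner_polySpinOrbit (f g : SpinPoly) :
    ⟪spinEval (polySpinOrbit f), spinEval g⟫_ℂ = ⟪spinEval f, spinEval (polySpinOrbit g)⟫_ℂ := by
  have h := dirac_symmetric (spinEval_mem_graph_dirac f) (spinEval_mem_graph_dirac g)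
  simp only [polyDirac, map_add, map_smul, inner_add_left, inner_add_right, inner_smul_left,
    inner_smul_right, map_div₀, map_ofNat] at h
  exact add_right_cancel h

/-- The quadratic form of the Casimir operator in terms of the spin-orbit coupling. -/
theorem sum_norm_sq_polyGen (f : SpinPoly) :
    4 * ∑ j, ‖spinEval fun a => polyGen j (f a)‖ ^ 2 = ‖spinEval (polySpinOrbit f)‖ ^ 2 +
      2 * (⟪spinEval f, spinEval (polySpinOrbit f)⟫_ℂ).re := by
  -- Polynomial spinors are invariant under $B_j$, so symmetry gives $\|B_jf\|^2 = \langle f,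
  -- B_j^2f\rangle$.
  have h1 : ∀ j, ‖spinEval fun a => polyGen j (f a)‖ ^ 2 =
      (⟪spinEval f, spinEval fun a => polyGen j (polyGen j (f a))⟫_ℂ).re := fun j => by
    rw [@norm_sq_eq_re_inner ℂ, rightGen_symmetric (spinEval_mem_graph j f)
      (spinEval_mem_graph j fun a => polyGen j (f a))]
    rfl
  have h2 : (4 : ℂ) • ∑ j, (fun a => polyGen j (polyGen j (f a)) : SpinPoly) =
      polySpinOrbit (polySpinOrbit f) + (2 : ℂ) • polySpinOrbit f := by
    funext a
    simpa using four_casimir f a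
  have h3 := congrArg (fun g => (⟪spinEval f, spinEval g⟫_ℂ).re) h2
  simp only [map_add, map_smul, map_sum, inner_add_right, inner_smul_right, inner_sum,
    ← inner_polySpinOrbit f (polySpinOrbit f)] at h3
  simp only [h1, @norm_sq_eq_re_inner ℂ _ _ _ _ (spinEval (polySpinOrbit f))]
  simpa [Complex.mul_re] using h3

/-- The elliptic estimate: the identity $4\sum\|B_jf\|^2 = \|Tf\|^2 + 2\langle f,Tf\rangle$ controls
every $B_j$ by $T = D-\frac32$. It makes graph convergence for $D$ imply graph convergence for all
$B_j$. The constant $3$ is not sharp. -/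
theorem norm_polyGen_le (j : Fin 3) {f : SpinPoly} {y : HydrogenSpace}
    (h : (spinEval f, y) ∈ dirac.graph) :
    ‖spinEval fun a => polyGen j (f a)‖ ≤ ‖y‖ + 3 * ‖spinEval f‖ := by
  have h1 := sum_norm_sq_polyGen f
  have h2 : ‖spinEval (polySpinOrbit f)‖ ≤ ‖y‖ + 3 / 2 * ‖spinEval f‖ := by
    have h3 : spinEval (polySpinOrbit f) = y - (3 / 2 : ℂ) • spinEval f := by
      rw [graph_snd_unique h (spinEval_mem_graph_dirac f), polyDirac, map_add, map_smul,
        add_sub_cancel_right]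
    rw [h3]
    refine (norm_sub_le _ _).trans (le_of_eq ?_)
    rw [norm_smul]
    norm_num
  have h3 : (⟪spinEval f, spinEval (polySpinOrbit f)⟫_ℂ).re ≤
      ‖spinEval f‖ * ‖spinEval (polySpinOrbit f)‖ :=
    re_inner_le_norm (𝕜 := ℂ) _ _
  have h4 : ‖spinEval fun a => polyGen j (f a)‖ ^ 2 ≤ ∑ j, ‖spinEval fun a => polyGen j (f a)‖ ^ 2 :=
    Finset.single_le_sum (f := fun j => ‖spinEval fun a => polyGen j (f a)‖ ^ 2)
      (fun _ _ => sq_nonneg _) (Finset.mem_univ j)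
  rw [← mul_le_mul_iff_right₀ (zero_lt_four' ℝ), h1] at h4
  have h5 := norm_nonneg (spinEval f)
  have h6 := norm_nonneg (spinEval (polySpinOrbit f))
  have h7 := norm_nonneg y
  generalize ‖spinEval fun a => polyGen j (f a)‖ = A at *
  generalize ‖spinEval (polySpinOrbit f)‖ = X at *
  generalize ‖spinEval f‖ = F at *
  generalize ‖y‖ = Y at *
  refine (abs_le_of_sq_le_sq' (a := A) ?_ (by linarith)).2
  nlinarith [mul_nonneg h5 h6, mul_nonneg h5 h7, mul_le_mul h2 h2 h6 (by linarith),
    mul_le_mul_of_nonneg_left h2 h5]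

/-- There is an orthonormal basis of polynomial eigenvectors of the Dirac operator, and `0` is not one of
the eigenvalues. -/
theorem exists_dirac_eigenbasis : ∃ (ι : Type) (b : HilbertBasis ι ℂ HydrogenSpace) (l : ι → ℝ)
    (p : ι → SpinPoly), (∀ k, spinEval (p k) = b k) ∧
      (∀ k, (b k, (l k : ℂ) • b k) ∈ dirac.graph) ∧ ∀ k, l k ≠ 0 := by
  have hfin : ∀ n, FiniteDimensional ℂ ((spinDeg n).map spinEval) := fun n =>
    Module.Finite.iff_fg.mpr ((fg_spinDeg n).map spinEval)
  obtain ⟨ι, b, l, hb, hp⟩ := exists_hilbertBasis_eigen (A := dirac) dirac_symmetric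
    (fun n => (spinDeg n).map spinEval) (fun m n h => Submodule.map_mono (monotone_spinDeg h))
    (by
      rintro n _ ⟨f, hf, rfl⟩
      exact ⟨_, ⟨_, add_mem (polySpinOrbit_mem_spinDeg hf) (Submodule.smul_mem _ _ hf), rfl⟩,
        spinEval_mem_graph_dirac f⟩)
    (by
      rw [← Submodule.dense_iff_topologicalClosure_eq_top]
      refine denseRange_spinEval.mono ?_
      rintro _ ⟨f, rfl⟩
      obtain ⟨n, hn⟩ := exists_mem_spinDeg f
      exact Submodule.mem_iSup_of_mem n ⟨f, hn, rfl⟩)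
  choose n p hpn hp using hp
  refine ⟨ι, b, l, p, hp, hb, fun k hk => ?_⟩
  -- If $Db_k = 0$ then $Tb_k = -\frac32 b_k$, and the Casimir identity gives $4\sum\|B_jb_k\|^2 =
  -- \frac94 - 3 < 0$.
  have h1 := sum_norm_sq_polyGen (p k)
  have h2 := graph_snd_unique (hp k ▸ hb k) (spinEval_mem_graph_dirac (p k))
  rw [hk, Complex.ofReal_zero, zero_smul, polyDirac, map_add, map_smul] at h2
  have h3 : spinEval (polySpinOrbit (p k)) = (-(3 / 2) : ℂ) • b k := by
    rw [← hp k, neg_smul]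
    exact eq_neg_of_add_eq_zero_left h2.symm
  have hn1 : ‖b k‖ = 1 := b.orthonormal.1 k
  rw [h3, hp k, norm_smul, inner_smul_right, inner_self_eq_norm_sq_to_K, hn1] at h1
  have h4 : 0 ≤ ∑ j, ‖spinEval fun a => polyGen j (p k a)‖ ^ 2 :=
    Finset.sum_nonneg fun _ _ => sq_nonneg _
  norm_num at h1
  linarith

end DiracOperator

/-! ### The Dirac operator as the generator of a diagonal unitary group -/

noncomputable section DiracGroup

/-- Testing a symmetric operator against an eigenbasis determines all coefficients of its values, so
it is contained in the maximal diagonal operator. -/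
theorem dirac_le_diagGroup {ι : Type*} {b : HilbertBasis ι ℂ HydrogenSpace} {l : ι → ℝ}
    (hb : ∀ k, (b k, (l k : ℂ) • b k) ∈ dirac.graph) {x y : HydrogenSpace}
    (h : (x, y) ∈ dirac.graph) : (x, y) ∈ (stoneGenerator (diagGroup b l)).graph := by
  rw [mem_graph_diagGroup]
  intro k
  rw [← dirac_symmetric (hb k) h, inner_smul_left, Complex.conj_ofReal]

/-- The common domain of the generators is complete for the graph norm of the Dirac operator. -/
theorem mem_graph_dirac_of_tendsto {β : Type*} [SemilatticeSup β] [Nonempty β] {f : β → SpinPoly}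
    {x y : HydrogenSpace} (hx : Filter.Tendsto (fun s => spinEval (f s)) Filter.atTop (nhds x))
    (hy : Filter.Tendsto (fun s => spinEval (polyDirac (f s))) Filter.atTop (nhds y)) :
    (x, y) ∈ dirac.graph := by
  have hlim : ∀ j, ∃ η, Filter.Tendsto (fun s => spinEval fun a => polyGen j (f s a)) Filter.atTop
      (nhds η) := by
    intro j
    refine cauchySeq_tendsto_of_complete ?_
    rw [cauchySeq_iff_tendsto_dist_atTop_0]
    have hx' := cauchySeq_iff_tendsto_dist_atTop_0.mp hx.cauchySeq
    have hy' := cauchySeq_iff_tendsto_dist_atTop_0.mp hy.cauchySeq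
    have hsum := hy'.add (hx'.const_mul 3)
    rw [mul_zero, add_zero] at hsum
    refine squeeze_zero (fun _ => dist_nonneg) (fun s => ?_) hsum
    -- The Casimir estimate applied to differences shows that the $B_jf_s$ are Cauchy; closedness of
    -- each $B_j$ then puts $x$ in the common domain.
    have hg := dirac.graph.sub_mem (spinEval_mem_graph_dirac (f s.1)) (spinEval_mem_graph_dirac (f s.2))
    rw [Prod.mk_sub_mk, ← map_sub spinEval (f s.1)] at hg
    have h := norm_polyGen_le j hg
    rw [map_sub spinEval (f s.1), ← dist_eq_norm, ← dist_eq_norm] at h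
    refine le_of_eq_of_le ?_ h
    rw [dist_eq_norm, ← map_sub]
    congr 2
    funext a
    simp
  choose η hη using hlim
  refine mem_graph_dirac.mpr ⟨η, fun j => ?_, tendsto_nhds_unique hy ?_⟩
  · exact (isOneParam_rightTranslate j).closed (fun s => spinEval_mem_graph j (f s)) hx (hη j)
  · simp only [spinEval_polyDirac]
    exact ((tendsto_finsetSum _ fun j _ => ((spinOp _).continuous.tendsto _).comp (hη j)).const_smul
      (4 : ℂ)).add (hx.const_smul (3 / 2 : ℂ))

/-- Polynomial spinors are a core: partial sums of the eigenvector expansion are polynomial and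
converge in the graph norm. -/
theorem exists_tendsto_of_mem_graph {ι : Type*} {b : HilbertBasis ι ℂ HydrogenSpace} {l : ι → ℝ}
    {p : ι → SpinPoly} (hp : ∀ k, spinEval (p k) = b k)
    (hb : ∀ k, (b k, (l k : ℂ) • b k) ∈ dirac.graph) {x y : HydrogenSpace}
    (h : (x, y) ∈ (stoneGenerator (diagGroup b l)).graph) : ∃ f : Finset ι → SpinPoly,
      Filter.Tendsto (fun s => spinEval (f s)) Filter.atTop (nhds x) ∧
      Filter.Tendsto (fun s => spinEval (polyDirac (f s))) Filter.atTop (nhds y) := by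
  have hf : ∀ s : Finset ι, spinEval (∑ k ∈ s, ⟪b k, x⟫_ℂ • p k) = ∑ k ∈ s, ⟪b k, x⟫_ℂ • b k := by
    intro s
    simp only [map_sum, map_smul, hp]
  have hDf : ∀ s : Finset ι, spinEval (polyDirac (∑ k ∈ s, ⟪b k, x⟫_ℂ • p k)) =
      ∑ k ∈ s, ⟪b k, x⟫_ℂ • (l k : ℂ) • b k := by
    intro s
    -- The diagonal operator contains $D$ and is known on finite sums of basis vectors, so
    -- single-valuedness evaluates $D$ on the partial sum.
    have hg := dirac_le_diagGroup hb (spinEval_mem_graph_dirac (∑ k ∈ s, ⟪b k, x⟫_ℂ • p k))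
    rw [hf] at hg
    exact graph_snd_unique hg (sum_basis_mem_graph b l s _)
  rw [mem_graph_diagGroup] at h
  refine ⟨fun s => ∑ k ∈ s, ⟪b k, x⟫_ℂ • p k, ?_, ?_⟩
  · simp only [hf]
    simpa only [HasSum, SummationFilter.unconditional_filter, b.repr_apply_apply] using b.hasSum_repr x
  · have h2 := b.hasSum_repr y
    simp only [HasSum, SummationFilter.unconditional_filter, b.repr_apply_apply, h] at h2
    simpa only [hDf, smul_smul, mul_comm] using h2

theorem stoneGenerator_diagGroup_eq {ι : Type*} {b : HilbertBasis ι ℂ HydrogenSpace} {l : ι → ℝ}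
    {p : ι → SpinPoly} (hp : ∀ k, spinEval (p k) = b k)
    (hb : ∀ k, (b k, (l k : ℂ) • b k) ∈ dirac.graph) : stoneGenerator (diagGroup b l) = dirac := by
  refine eq_of_graph_iff fun x y => ⟨fun h => ?_, dirac_le_diagGroup hb⟩
  classical
  obtain ⟨f, hx, hy⟩ := exists_tendsto_of_mem_graph hp hb h
  exact mem_graph_dirac_of_tendsto hx hy

theorem isUnitaryGroupOf_dirac : IsUnitaryGroupOf dirac (unitaryGroup dirac) := by
  obtain ⟨ι, b, l, p, hp, hb, -⟩ := exists_dirac_eigenbasis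
  exact unitaryGroup_spec (U := diagGroup b l)
    ⟨(isOneParam_diagGroup b l).zero, (isOneParam_diagGroup b l).add, continuous_diagGroup b l,
      stoneGenerator_diagGroup_eq hp hb⟩

theorem dense_dirac_domain : Dense (dirac.domain : Set HydrogenSpace) := by
  refine denseRange_spinEval.mono ?_
  rintro _ ⟨f, rfl⟩
  exact LinearPMap.mem_domain_iff.mpr ⟨_, spinEval_mem_graph_dirac f⟩

/-- Commutation holds on the core of polynomial spinors by the invariance of the spin-orbit term,
and passes to graph limits because `rho g` is continuous and preserves the core. -/
theorem rho_mem_graph_dirac (g : SU2 × SU2) {x y : HydrogenSpace} (h : (x, y) ∈ dirac.graph) :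
    (rho g x, rho g y) ∈ dirac.graph := by
  classical
  obtain ⟨ι, b, l, p, hp, hb, -⟩ := exists_dirac_eigenbasis
  rw [← stoneGenerator_diagGroup_eq hp hb] at h
  obtain ⟨f, hx, hy⟩ := exists_tendsto_of_mem_graph hp hb h
  have hx' := ((rho g).continuous.tendsto _).comp hx
  have hy' := ((rho g).continuous.tendsto _).comp hy
  have hinv : (g.2 : Matrix (Fin 2) (Fin 2) ℂ) * (g.2⁻¹ : SU2) = 1 := by
    rw [← Submonoid.coe_mul, mul_inv_cancel]; rfl
  simp only [Function.comp_def, rho_spinEval] at hx' hy'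
  have hD : ∀ f, substSpin (g.1⁻¹ : SU2) g.2 (polyDirac f) =
      polyDirac (substSpin (g.1⁻¹ : SU2) g.2 f) := by
    intro f
    rw [polyDirac, polyDirac, substSpin_polySpinOrbit hinv]
    funext a
    simp only [substSpin, Pi.add_apply, Pi.smul_apply, map_add, map_smul, smul_add,
      Finset.sum_add_distrib, Finset.smul_sum, smul_comm _ (3 / 2 : ℂ)]
  simp only [hD] at hy'
  exact mem_graph_dirac_of_tendsto hx' hy'

end DiracGroup

/-! ### Positive and negative spectral subspaces and their projections -/

noncomputable section SpectralSubspaces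

/-- The eigenvectors of `A` with an eigenvalue in `s`. -/
def eigenSet {E : Type*} [NormedAddCommGroup E] [InnerProductSpace ℂ E] (A : E →ₗ.[ℂ] E)
    (s : Set ℝ) : Set E := {ψ | ∃ l ∈ s, (ψ, (l : ℂ) • ψ) ∈ A.graph}

section

variable {E : Type*} [NormedAddCommGroup E] [InnerProductSpace ℂ E] {A : E →ₗ.[ℂ] E} {s t : Set ℝ}

theorem eigenSpan_eq : eigenSpan A s = (Submodule.span ℂ (eigenSet A s)).topologicalClosure := by
  have h : {ψ : E | ∃ l ∈ s, ∃ h : ψ ∈ A.domain, A ⟨ψ, h⟩ = (l : ℂ) • ψ} = eigenSet A s := by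
    ext ψ
    refine exists_congr fun l => and_congr_right fun _ => ?_
    rw [LinearPMap.mem_graph_iff]
    constructor
    · rintro ⟨h, h2⟩
      exact ⟨⟨ψ, h⟩, rfl, h2⟩
    · rintro ⟨⟨φ, h⟩, rfl, h2⟩
      exact ⟨h, h2⟩
  rw [eigenSpan, h]

theorem subset_eigenSpan : eigenSet A s ⊆ eigenSpan A s := by
  rw [eigenSpan_eq]
  exact Submodule.subset_span.trans (Submodule.le_topologicalClosure _)

theorem eigenSpan_le {K : Submodule ℂ E} (hK : IsClosed (K : Set E)) (h : eigenSet A s ⊆ K) :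
    eigenSpan A s ≤ K := by
  rw [eigenSpan_eq]
  exact Submodule.topologicalClosure_minimal _ (Submodule.span_le.mpr h) hK

theorem isClosed_eigenSpan : IsClosed (eigenSpan A s : Set E) :=
  Submodule.isClosed_topologicalClosure _

/-- A bounded real-linear operator which maps eigenvectors to eigenvectors preserves their closed
span. -/
theorem map_mem_eigenSpan (L : E →L[ℝ] E)
    (hL : ∀ (l : ℝ) x, (x, (l : ℂ) • x) ∈ A.graph → (L x, (l : ℂ) • L x) ∈ A.graph) {x : E}
    (hx : x ∈ eigenSpan A s) : L x ∈ eigenSpan A s := by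
  have h1 : Set.MapsTo L (Submodule.span ℂ (eigenSet A s)) (eigenSpan A s) := by
    intro x hx
    change x ∈ Submodule.span ℂ (eigenSet A s) at hx
    -- `L` may be antilinear, so scalars cannot be pulled through it; here they are absorbed into
    -- the eigenvectors, leaving only additivity to use.
    induction hx using Submodule.closure_induction with
    | zero => rw [map_zero]; exact zero_mem _
    | add x y _ _ hx hy => rw [map_add]; exact add_mem hx hy
    | smul_mem c x hx =>
      obtain ⟨l, hl, hx⟩ := hx
      refine subset_eigenSpan ⟨l, hl, hL l _ ?_⟩
      have := A.graph.smul_mem c hx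
      rwa [Prod.smul_mk, smul_comm] at this
  rw [eigenSpan_eq] at hx
  have h2 := h1.closure L.continuous hx
  rwa [isClosed_eigenSpan.closure_eq] at h2

/-- Eigenvectors of a symmetric operator with distinct real eigenvalues are orthogonal; passing to
the closed span in each argument separately gives the claim. -/
theorem eigenSpan_isOrtho
    (hA : ∀ {x y x' y'}, (x, y) ∈ A.graph → (x', y') ∈ A.graph → ⟪y, x'⟫_ℂ = ⟪x, y'⟫_ℂ)
    (hst : Disjoint s t) : eigenSpan A s ≤ (eigenSpan A t)ᗮ := by
  refine eigenSpan_le (Submodule.isClosed_orthogonal _) fun x hx => ?_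
  have h1 : eigenSpan A t ≤ (Submodule.span ℂ {x})ᗮ := by
    refine eigenSpan_le (Submodule.isClosed_orthogonal _) fun y hy => ?_
    obtain ⟨l, hl, hx⟩ := hx
    obtain ⟨m, hm, hy⟩ := hy
    refine Submodule.mem_orthogonal_singleton_iff_inner_right.mpr ?_
    have h := hA hx hy
    rw [inner_smul_left, inner_smul_right, Complex.conj_ofReal] at h
    have hne : (l : ℂ) - m ≠ 0 := by
      rw [sub_ne_zero]
      intro h
      rw [Complex.ofReal_inj] at h
      exact Set.disjoint_left.mp hst hl (h ▸ hm)
    have h2 : ((l : ℂ) - m) * ⟪x, y⟫_ℂ = 0 := by linear_combination h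
    exact (mul_eq_zero.mp h2).resolve_left hne
  intro y hy
  exact Submodule.mem_orthogonal_singleton_iff_inner_left.mp (h1 hy)

end

theorem positiveSpace_le : positiveSpace ≤ negativeSpaceᗮ :=
  eigenSpan_isOrtho dirac_symmetric
    (Set.disjoint_left.mpr fun _ h h' => lt_asymm (Set.mem_Ioi.mp h) (Set.mem_Iio.mp h'))

theorem negativeSpace_le : negativeSpace ≤ positiveSpaceᗮ :=
  eigenSpan_isOrtho dirac_symmetric
    (Set.disjoint_left.mpr fun _ h h' => lt_asymm (Set.mem_Ioi.mp h') (Set.mem_Iio.mp h))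

/-- A vector orthogonal to both subspaces is orthogonal to every member of the eigenbasis, since no
eigenvalue is $0$; hence it vanishes. -/
theorem negativeSpace_orthogonal : negativeSpaceᗮ = positiveSpace := by
  refine le_antisymm (fun x hx => ?_) positiveSpace_le
  obtain ⟨ι, b, l, p, hp, hb, hl⟩ := exists_dirac_eigenbasis
  have hy : positiveSpace.starProjection x ∈ positiveSpace := Submodule.starProjection_apply_mem _ _
  have h1 : x - positiveSpace.starProjection x ∈ positiveSpaceᗮ :=
    Submodule.sub_starProjection_mem_orthogonal x
  have h2 : x - positiveSpace.starProjection x ∈ negativeSpaceᗮ := sub_mem hx (positiveSpace_le hy)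
  have h3 : x - positiveSpace.starProjection x = 0 := by
    refine HilbertBasis.ext_inner (b := b) fun k => ?_
    rw [inner_zero_right]
    rcases lt_or_gt_of_ne (hl k) with h | h
    · exact (Submodule.mem_orthogonal _ _).mp h2 _ (subset_eigenSpan ⟨l k, h, hb k⟩)
    · exact (Submodule.mem_orthogonal _ _).mp h1 _ (subset_eigenSpan ⟨l k, h, hb k⟩)
  rw [sub_eq_zero.mp h3]
  exact hy

theorem starProjection_positiveSpace (ψ : HydrogenSpace) :
    positiveSpace.starProjection ψ = ψ - negativeSpace.starProjection ψ := by
  refine Submodule.eq_starProjection_of_mem_orthogonal (K := positiveSpace) ?_ ?_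
  · rw [← negativeSpace_orthogonal]
    exact Submodule.sub_starProjection_mem_orthogonal ψ
  · rw [sub_sub_cancel]
    exact negativeSpace_le (Submodule.starProjection_apply_mem _ _)

/-- A bounded real-linear operator which maps eigenvectors of the Dirac operator to eigenvectors
commutes with the spectral projection. -/
theorem starProjection_negativeSpace_comm (L : HydrogenSpace →L[ℝ] HydrogenSpace)
    (hL : ∀ (l : ℝ) x, (x, (l : ℂ) • x) ∈ dirac.graph → (L x, (l : ℂ) • L x) ∈ dirac.graph)
    (ψ : HydrogenSpace) :
    negativeSpace.starProjection (L ψ) = L (negativeSpace.starProjection ψ) := by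
  refine Submodule.eq_starProjection_of_mem_orthogonal'
    (z := L (ψ - negativeSpace.starProjection ψ)) ?_ ?_ ?_
  · exact map_mem_eigenSpan L hL (Submodule.starProjection_apply_mem _ _)
  · rw [negativeSpace_orthogonal]
    refine map_mem_eigenSpan L hL ?_
    change _ ∈ positiveSpace
    rw [← negativeSpace_orthogonal]
    exact Submodule.sub_starProjection_mem_orthogonal ψ
  · rw [← map_add, add_sub_cancel]

/-- Each $e^{itD}$ maps eigenvectors to eigenvectors with the same eigenvalue, so it commutes with
$p_-$; a bounded operator commuting with the group acts on the graph of its generator. -/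
theorem starProjection_mem_graph_dirac {x y : HydrogenSpace} (h : (x, y) ∈ dirac.graph) :
    (negativeSpace.starProjection x, negativeSpace.starProjection y) ∈ dirac.graph := by
  have hU := isUnitaryGroupOf_dirac
  have hcomm : ∀ t x, unitaryGroup dirac t (negativeSpace.starProjection x) =
      negativeSpace.starProjection (unitaryGroup dirac t x) := by
    intro t x
    refine (starProjection_negativeSpace_comm
      ((unitaryGroup dirac t).toContinuousLinearEquiv.toContinuousLinearMap.restrictScalars ℝ)
      (fun l x hx => ?_) x).symm
    have h1 := hU.isOneParam.graph_invariant (by rw [hU.generator]; exact hx) t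
    rw [hU.generator, map_smul] at h1
    exact h1
  rw [← hU.generator] at h
  have h2 := mem_graph_stoneGenerator_of_commute (negativeSpace.starProjection.restrictScalars ℝ)
    hcomm h (map_smul negativeSpace.starProjection _ _).symm
  rwa [hU.generator] at h2

end SpectralSubspaces

/-! ### Charge conjugation commutes with the representation and the Dirac operator -/

noncomputable section ChargeConjugation

theorem chargeConj_ae (ψ : HydrogenSpace) :
    chargeConj ψ =ᵐ[sphereMeasure] fun x => spinConj (ψ x) :=
  spinConj.coeFn_compLpL ψ

theorem spinConj_zero (v : Spin) : spinConj v 0 = starRingEnd ℂ (v 1) := by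
  simp [spinConj, dotProduct, Fin.sum_univ_two]

theorem spinConj_one (v : Spin) : spinConj v 1 = -starRingEnd ℂ (v 0) := by
  simp [spinConj, dotProduct, Fin.sum_univ_two]

theorem chargeConj_chargeConj (ψ : HydrogenSpace) : chargeConj (chargeConj ψ) = -ψ := by
  apply Lp.ext
  filter_upwards [chargeConj_ae (chargeConj ψ), chargeConj_ae ψ, Lp.coeFn_neg ψ] with x h1 h2 h3
  rw [h1, h2, h3]
  ext i
  fin_cases i <;> simp [spinConj_zero, spinConj_one]

theorem norm_chargeConj (ψ : HydrogenSpace) : ‖chargeConj ψ‖ = ‖ψ‖ := by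
  rw [Lp.norm_def, Lp.norm_def]
  congr 1
  refine eLpNorm_congr_norm_ae ?_
  filter_upwards [chargeConj_ae ψ] with x hx
  rw [hx, EuclideanSpace.norm_eq, EuclideanSpace.norm_eq, Fin.sum_univ_two, Fin.sum_univ_two,
    spinConj_zero, spinConj_one, norm_neg, RCLike.norm_conj, RCLike.norm_conj, add_comm]

/-- The defining representation of SU(2) is quaternionic: $\epsilon\bar g = g\epsilon$, because
$\bar g$ is given by the adjugate. -/
theorem spinConj_SU2 (g : SU2) (v : Spin) :
    spinConj (Matrix.toEuclideanCLM (𝕜 := ℂ) (g : Matrix (Fin 2) (Fin 2) ℂ) v) =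
      Matrix.toEuclideanCLM (𝕜 := ℂ) (g : Matrix (Fin 2) (Fin 2) ℂ) (spinConj v) := by
  have h := star_SU2_apply g
  simp only [Matrix.adjugate_fin_two, ← starRingEnd_apply] at h
  ext i
  fin_cases i <;>
    simp [spinConj_zero, spinConj_one, Matrix.mulVec, dotProduct, Fin.sum_univ_two, h]; ring

/-- This is $\epsilon\bar\sigma_j = -\sigma_j\epsilon$, the infinitesimal form of $\epsilon\bar g =
g\epsilon$ with $g = e^{it\sigma_j/2}$: the $i$ in the exponent produces the sign. -/
theorem spinConj_pauli (j : Fin 3) (v : Spin) :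
    spinConj (Matrix.toEuclideanCLM (𝕜 := ℂ) ((1 / 2 : ℂ) • pauli j) v) =
      -Matrix.toEuclideanCLM (𝕜 := ℂ) ((1 / 2 : ℂ) • pauli j) (spinConj v) := by
  ext i
  fin_cases j <;> fin_cases i <;>
    simp [spinConj_zero, spinConj_one, Matrix.mulVec, dotProduct, Fin.sum_univ_two, pauli] <;>
    exact Or.inl (map_ofNat _ 2)

theorem chargeConj_translate (g : SU2 × SU2) (ψ : HydrogenSpace) :
    chargeConj (translate g ψ) = translate g (chargeConj ψ) := by
  apply Lp.ext
  filter_upwards [chargeConj_ae (translate g ψ), translate_ae g ψ, translate_ae g (chargeConj ψ),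
    (measurePreserving_translate g).quasiMeasurePreserving.ae_eq_comp (chargeConj_ae ψ)]
    with x h1 h2 h3 h4
  rw [h1, h2, h3]
  exact h4.symm

theorem chargeConj_rho (g : SU2 × SU2) (ψ : HydrogenSpace) :
    chargeConj (rho g ψ) = rho g (chargeConj ψ) := by
  change chargeConj (spinOp g.2 (translate g ψ)) = spinOp g.2 (translate g (chargeConj ψ))
  rw [← chargeConj_translate]
  apply Lp.ext
  filter_upwards [chargeConj_ae (spinOp g.2 (translate g ψ)), spinOp_ae g.2 (translate g ψ),
    spinOp_ae g.2 (chargeConj (translate g ψ)), chargeConj_ae (translate g ψ)] with x h1 h2 h3 h4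
  rw [h1, h2, h3, h4, spinConj_SU2]

theorem chargeConj_spinOp (j : Fin 3) (ψ : HydrogenSpace) :
    chargeConj (spinOp ((1 / 2 : ℂ) • pauli j) ψ) = -spinOp ((1 / 2 : ℂ) • pauli j) (chargeConj ψ) := by
  apply Lp.ext
  filter_upwards [chargeConj_ae (spinOp ((1 / 2 : ℂ) • pauli j) ψ), spinOp_ae ((1 / 2 : ℂ) • pauli j) ψ,
    spinOp_ae ((1 / 2 : ℂ) • pauli j) (chargeConj ψ), chargeConj_ae ψ,
    Lp.coeFn_neg (spinOp ((1 / 2 : ℂ) • pauli j) (chargeConj ψ))] with x h1 h2 h3 h4 h5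
  rw [h1, h2, h5, Pi.neg_apply, h3, h4, spinConj_pauli]

/-- Charge conjugation as a real-linear map. -/
def chargeConjReal : HydrogenSpace →L[ℝ] HydrogenSpace where
  toFun := chargeConj
  map_add' := map_add _
  map_smul' r x := by
    change chargeConj ((r : ℂ) • x) = (r : ℂ) • chargeConj x
    rw [map_smulₛₗ, Complex.conj_ofReal]
  cont := chargeConj.continuous

theorem chargeConj_mem_graph_dirac {x y : HydrogenSpace} (h : (x, y) ∈ dirac.graph) :
    (chargeConj x, chargeConj y) ∈ dirac.graph := by
  obtain ⟨η, hη, rfl⟩ := mem_graph_dirac.mp h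
  -- $C$ commutes with right translations $e^{itB_j}$ and is antilinear, so $CB_j = -B_jC$. This
  -- sign cancels the one from $CS_j = -S_jC$, and $C$ commutes with $D$.
  refine mem_graph_dirac.mpr ⟨fun j => -chargeConj (η j), fun j => ?_, ?_⟩
  · refine mem_graph_stoneGenerator_of_commute chargeConjReal
      (fun _ x => (chargeConj_translate _ x).symm) (hη j) ?_
    change _ = chargeConj (Complex.I • η j)
    rw [map_smulₛₗ, Complex.conj_I, smul_neg, neg_smul]
  · simp only [map_add, map_smulₛₗ, map_sum, chargeConj_spinOp, map_neg, map_div₀, map_ofNat]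

theorem chargeConj_starProjection (ψ : HydrogenSpace) :
    negativeSpace.starProjection (chargeConj ψ) = chargeConj (negativeSpace.starProjection ψ) := by
  refine starProjection_negativeSpace_comm chargeConjReal (fun l x hx => ?_) ψ
  have h := chargeConj_mem_graph_dirac hx
  rw [map_smulₛₗ, Complex.conj_ofReal] at h
  exact h

theorem rho_starProjection (g : SU2 × SU2) (ψ : HydrogenSpace) :
    negativeSpace.starProjection (rho g ψ) = rho g (negativeSpace.starProjection ψ) := by
  refine starProjection_negativeSpace_comm
    ((rho g).toContinuousLinearEquiv.toContinuousLinearMap.restrictScalars ℝ) (fun l x hx => ?_) ψ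
  have h := rho_mem_graph_dirac g hx
  rw [map_smul] at h
  exact h

end ChargeConjugation

/-! ### The one-particle equivalence with the Weyl Hilbert space -/

noncomputable section Equivalence

theorem starProjection_starProjection (ψ : HydrogenSpace) :
    negativeSpace.starProjection (negativeSpace.starProjection ψ) = negativeSpace.starProjection ψ :=
  Submodule.starProjection_eq_self_iff.mpr (Submodule.starProjection_apply_mem _ ψ)

/-- The map `p₊ + C p₋`. -/
def conjNegative (ψ : HydrogenSpace) : HydrogenSpace :=
  positiveSpace.starProjection ψ + chargeConj (negativeSpace.starProjection ψ)

/-- The map `p₊ - C p₋`, inverse to `p₊ + C p₋`. -/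
def conjNegativeInv (ψ : HydrogenSpace) : HydrogenSpace :=
  positiveSpace.starProjection ψ - chargeConj (negativeSpace.starProjection ψ)

theorem starProjection_conjNegative (ψ : HydrogenSpace) :
    negativeSpace.starProjection (conjNegative ψ) = chargeConj (negativeSpace.starProjection ψ) := by
  simp only [conjNegative, starProjection_positiveSpace, map_add, map_sub,
    starProjection_starProjection, chargeConj_starProjection, sub_self, zero_add]

theorem starProjection_conjNegativeInv (ψ : HydrogenSpace) :
    negativeSpace.starProjection (conjNegativeInv ψ) =
      -chargeConj (negativeSpace.starProjection ψ) := by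
  simp only [conjNegativeInv, starProjection_positiveSpace, map_sub,
    starProjection_starProjection, chargeConj_starProjection, sub_self, zero_sub]

/-- Since $C$ preserves the negative subspace and $C^2 = -1$, changing the sign of $C$ inverts the
map. -/
theorem conjNegativeInv_conjNegative (ψ : HydrogenSpace) : conjNegativeInv (conjNegative ψ) = ψ := by
  rw [conjNegativeInv, starProjection_positiveSpace, starProjection_conjNegative,
    chargeConj_chargeConj, conjNegative, starProjection_positiveSpace]
  abel

theorem conjNegative_conjNegativeInv (ψ : HydrogenSpace) : conjNegative (conjNegativeInv ψ) = ψ := by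
  rw [conjNegative, starProjection_positiveSpace, starProjection_conjNegativeInv, map_neg,
    chargeConj_chargeConj, conjNegativeInv, starProjection_positiveSpace]
  abel

/-- Pythagoras: $C$ is isometric and keeps the second summand in the negative subspace, orthogonal
to the first. -/
theorem norm_conjNegative (ψ : HydrogenSpace) : ‖conjNegative ψ‖ = ‖ψ‖ := by
  have h0 : ∀ v ∈ negativeSpace, ⟪ψ - negativeSpace.starProjection ψ, v⟫_ℂ = 0 := fun v hv =>
    (Submodule.mem_orthogonal' _ _).mp (Submodule.sub_starProjection_mem_orthogonal ψ) v hv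
  have h1 := norm_add_sq_eq_norm_sq_add_norm_sq_of_inner_eq_zero (𝕜 := ℂ) _ _
    (h0 _ (Submodule.starProjection_apply_mem negativeSpace ψ))
  have hmem : chargeConj (negativeSpace.starProjection ψ) ∈ negativeSpace := by
    rw [← chargeConj_starProjection]
    exact Submodule.starProjection_apply_mem _ _
  have h2 := norm_add_sq_eq_norm_sq_add_norm_sq_of_inner_eq_zero (𝕜 := ℂ) _ _ (h0 _ hmem)
  rw [norm_chargeConj, ← h1, sub_add_cancel, ← starProjection_positiveSpace] at h2
  exact (mul_self_inj_of_nonneg (norm_nonneg _) (norm_nonneg _)).mp h2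

theorem conjNegative_rho (g : SU2 × SU2) (ψ : HydrogenSpace) :
    conjNegative (rho g ψ) = rho g (conjNegative ψ) := by
  simp only [conjNegative, starProjection_positiveSpace, rho_starProjection, chargeConj_rho, map_add,
    map_sub]

theorem conjNegative_mem_graph {x y : HydrogenSpace} (h : (x, y) ∈ dirac.graph) :
    (conjNegative x, conjNegative y) ∈ dirac.graph := by
  have h1 := starProjection_mem_graph_dirac h
  have h2 := dirac.graph.add_mem (dirac.graph.sub_mem h h1) (chargeConj_mem_graph_dirac h1)
  rw [conjNegative, conjNegative, starProjection_positiveSpace, starProjection_positiveSpace]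
  exact h2

theorem conjNegativeInv_mem_graph {x y : HydrogenSpace} (h : (x, y) ∈ dirac.graph) :
    (conjNegativeInv x, conjNegativeInv y) ∈ dirac.graph := by
  have h1 := starProjection_mem_graph_dirac h
  have h2 := dirac.graph.sub_mem (dirac.graph.sub_mem h h1) (chargeConj_mem_graph_dirac h1)
  rw [conjNegativeInv, conjNegativeInv, starProjection_positiveSpace, starProjection_positiveSpace]
  exact h2

/-- The unitary map `F = I (p₊ + C p₋)` onto the Hilbert space of the Weyl equation. -/
def weylEquiv : HydrogenSpace ≃ₗᵢ[ℂ] WeylSpace where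
  toFun ψ := toWeyl (conjNegative ψ)
  map_add' x y := by
    change conjNegative (x + y) = conjNegative x + conjNegative y
    simp only [conjNegative, map_add]
    abel
  map_smul' z x := by
    rw [RingHom.id_apply, smul_toTwisted]
    congr 1
    -- With $S(p_+ + Cp_-) = p_+ - Cp_-$, multiplication by $z$ through $j$ acts as $z$ on the $p_+$
    -- part and as $\bar z$ on the $Cp_-$ part, and $\bar zC = Cz$.
    rw [newI, signOp_apply, starProjection_conjNegative]
    simp only [conjNegative, map_smul, map_smulₛₗ, smul_sub, smul_add]
    have hz : z = z.re + z.im * Complex.I := (Complex.re_add_im z).symm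
    have hz' : starRingEnd ℂ z = z.re - z.im * Complex.I := by
      apply Complex.ext <;> simp
    rw [hz']
    nth_rewrite 1 [hz]
    module
  invFun u := conjNegativeInv (toWeyl.symm u)
  left_inv := conjNegativeInv_conjNegative
  right_inv := conjNegative_conjNegativeInv
  norm_map' := norm_conjNegative

theorem weylEquiv_apply (ψ : HydrogenSpace) : weylEquiv ψ = toWeyl (conjNegative ψ) := rfl

theorem weylEquiv_conjNegativeInv (ψ : HydrogenSpace) : weylEquiv (conjNegativeInv ψ) = toWeyl ψ := by
  rw [weylEquiv_apply, conjNegative_conjNegativeInv]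

/-- The representation of SU(2) × SU(2) on the Hilbert space of the Weyl equation. -/
def weylRep : SU2 × SU2 →* (WeylSpace ≃ₗᵢ[ℂ] WeylSpace) where
  toFun g := (weylEquiv.symm.trans (rho g)).trans weylEquiv
  map_one' := by ext u; simp
  map_mul' g h := by ext u; simp

/-- The Dirac operator on the Hilbert space of the Weyl equation. -/
def weylDirac : WeylSpace →ₗ.[ℂ] WeylSpace :=
  stoneGenerator fun t => (weylEquiv.symm.trans (unitaryGroup dirac t)).trans weylEquiv

theorem mem_graph_weylDirac (x y : HydrogenSpace) :
    (weylEquiv x, weylEquiv y) ∈ weylDirac.graph ↔ (x, y) ∈ dirac.graph := by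
  rw [weylDirac, mem_graph_stoneGenerator_conj, isUnitaryGroupOf_dirac.generator]

/-- `weylDirac` is built by transport along $F$, which makes it a complex-linear operator by
construction; since $p_+ \pm Cp_-$ preserve the graph of $D$, it is the same operator as $D$ under
the identity map $I$. -/
theorem toWeyl_mem_graph_weylDirac (x y : HydrogenSpace) :
    (toWeyl x, toWeyl y) ∈ weylDirac.graph ↔ (x, y) ∈ dirac.graph := by
  rw [← weylEquiv_conjNegativeInv, ← weylEquiv_conjNegativeInv, mem_graph_weylDirac]
  refine ⟨fun h => ?_, conjNegativeInv_mem_graph⟩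
  have h2 := conjNegative_mem_graph h
  rwa [conjNegative_conjNegativeInv, conjNegative_conjNegativeInv] at h2

/-- Similarly, transport along $F$ agrees with transport along $I$ because $p_+ + Cp_-$ commutes
with $\rho$. -/
theorem weylRep_toWeyl (g : SU2 × SU2) (ψ : HydrogenSpace) :
    weylRep g (toWeyl ψ) = toWeyl (rho g ψ) := by
  rw [← weylEquiv_conjNegativeInv ψ]
  change weylEquiv (rho g (weylEquiv.symm (weylEquiv (conjNegativeInv ψ)))) = _
  rw [LinearIsometryEquiv.symm_apply_apply, weylEquiv_apply, conjNegative_rho,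
    conjNegative_conjNegativeInv]

end Equivalence

end KeplerFock

theorem theorem2 :
    (∀ ψ, signOp negativeSpace ψ =
      positiveSpace.starProjection ψ - negativeSpace.starProjection ψ) ∧
    IsUnitaryGroupOf dirac (unitaryGroup dirac) ∧
    ∃ (F : HydrogenSpace ≃ₗᵢ[ℂ] WeylSpace)
      (rhoWeyl : SU2 × SU2 →* (WeylSpace ≃ₗᵢ[ℂ] WeylSpace))
      (diracWeyl : WeylSpace →ₗ.[ℂ] WeylSpace),
      (∀ ψ, F ψ = toWeyl (positiveSpace.starProjection ψ +
        chargeConj (negativeSpace.starProjection ψ))) ∧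
      (∀ g ψ, rhoWeyl g (toWeyl ψ) = toWeyl (rho g ψ)) ∧
      (∀ ψ φ, (toWeyl ψ, toWeyl φ) ∈ diracWeyl.graph ↔ (ψ, φ) ∈ dirac.graph) ∧
      IsUnitaryGroupOf diracWeyl (unitaryGroup diracWeyl) ∧
      (∀ Φ, Continuous fun g => fockRep rho g Φ) ∧
      (∀ Φ, Continuous fun g => fockRep rhoWeyl g Φ) ∧
      (∀ g Φ, fockMap F (fockRep rho g Φ) = fockRep rhoWeyl g (fockMap F Φ)) ∧
      (∀ Φ, Φ ∈ (dFock dirac).domain ↔ fockMap F Φ ∈ (dFock diracWeyl).domain) ∧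
      (∀ (Φ : (dFock dirac).domain) (h : fockMap F Φ ∈ (dFock diracWeyl).domain),
        fockMap F (dFock dirac Φ) = dFock diracWeyl ⟨fockMap F Φ, h⟩) := by
  have hU := isUnitaryGroupOf_dirac
  -- One statement about graphs contains both the equality of domains and the intertwining of
  -- $d\Lambda(D)$.
  have hgraph : ∀ Φ Ψ, (fockMap weylEquiv Φ, fockMap weylEquiv Ψ) ∈ (dFock weylDirac).graph ↔
      (Φ, Ψ) ∈ (dFock dirac).graph := fun Φ Ψ => mem_graph_dFock weylEquiv
    (unitaryGroup_conj hU dense_dirac_domain weylEquiv mem_graph_weylDirac)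
  refine ⟨fun ψ => ?_, hU, weylEquiv, weylRep, weylDirac, fun ψ => rfl, weylRep_toWeyl,
    toWeyl_mem_graph_weylDirac, unitaryGroup_spec (hU.conj weylEquiv mem_graph_weylDirac),
    continuous_fockMap continuous_rho, continuous_fockMap fun u => ?_, fun g Φ => ?_, fun Φ => ?_,
    fun Φ h => ?_⟩
  · rw [signOp_apply, starProjection_positiveSpace]
    module
  · exact weylEquiv.continuous.comp (continuous_rho (weylEquiv.symm u))
  · change _ = fockMap ((weylEquiv.symm.trans (rho g)).trans weylEquiv) (fockMap weylEquiv Φ)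
    simp only [fockMap_trans, fockMap_symm, LinearIsometryEquiv.trans_apply,
      LinearIsometryEquiv.symm_apply_apply]
    rfl
  -- Surjectivity of $\Lambda(F)$ lets the unknown value on the Weyl side be written as
  -- $\Lambda(F)\Psi$.
  · rw [LinearPMap.mem_domain_iff, LinearPMap.mem_domain_iff, (fockMap weylEquiv).surjective.exists]
    exact exists_congr fun Ψ => (hgraph Φ Ψ).symm
  · exact graph_snd_unique ((hgraph _ _).mpr (LinearPMap.mem_graph _ Φ))
      (LinearPMap.mem_graph _ ⟨fockMap weylEquiv Φ, h⟩)
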